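/- For $\lambda\in(0,1)$ and $p\in(0,1)$ let $\nu_\lambda^p$ be the biased Bernoulli convolution, i.e. the distribution of the random series $\sum_{n=1}^\infty i_n\lambda^n$, where the $i_n$ are i.i.d. random variables taking the values $0,1$ with probabilities $p,1-p$ respectively. For $\alpha\in\mathbb R$ let $$\Delta_{\nu_\lambda^p}(\alpha)=\Big\{x\in\mathbb R:\ \lim_{r\searrow 0}\frac{\log \nu_\lambda^p(B(x,r))}{\log r}=\alpha\Big\},$$ where $B(x,r)$ is the open ball of center $x$ and radius $r$ (and $\log 0=-\infty$), let $h(q)=-q\log q-(1-q)\log(1-q)$ for $q\in[0,1]$ (with $0\log 0=0$), and let $\lambda_*=0.66847$. Fix $p\in(0,\tfrac12)$. For Lebesgue almost every $\lambda\in\big(\tfrac12,\min(\lambda_*,1-p)\big)$ the following holds: for Lebesgue almost every $$\alpha\in\Big[\frac{\log(1-p)}{\log\lambda},\,1\Big]$$ the set $\Delta_{\nu_\lambda^p}(\alpha)$ has positive Hausdorff dimension, and more precisely $$\dim_H\big(\Delta_{\nu_\lambda^p}(\alpha)\big)\ \ge\ \frac{h(q)}{|\log\lambda|},$$ where $q$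 is the unique real number with $\alpha\log\lambda=q\log p+(1-q)\log(1-p)$; this $q$ lies in $[0,1]$. -/

import Mathlib

open MeasureTheory Set Filter Topology

noncomputable section

/-- The Bernoulli measure `η^p = (p, 1 - p)^ℕ` on `{0,1}^ℕ`: the coordinates are i.i.d.,
equal to `0` with probability `p` and to `1` with probability `1 - p`. -/
def symbolicBernoulli (p : unitInterval) : Measure (ℕ → Fin 2) :=
  Measure.infinitePi fun _ : ℕ => ProbabilityTheory.bernoulliMeasure (0 : Fin 2) 1 p

/-- The natural projection `Π_lam (i_1, i_2, …) = ∑_{n ≥ 1} i_n lam ^ n`.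
The sequence is indexed from `0` here, so that `i (n)` stands for the digit `i_{n+1}`. -/
def natProj (lam : ℝ) (i : ℕ → Fin 2) : ℝ :=
  ∑' n : ℕ, ((i n : ℕ) : ℝ) * lam ^ (n + 1)

/-- The `p`-biased Bernoulli convolution `ν_lam^p`, for `lam ∈ (0, 1)`: the law of the random
series `∑_{n ≥ 1} i_n lam ^ n`, the image of the Bernoulli measure under the projection. -/
def bernoulliConvolution (lam : ℝ) (p : unitInterval) : Measure ℝ :=
  (symbolicBernoulli p).map (natProj lam)

/-- The finite measure `μ` has local dimension `α` (a real number) at `x`: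
`log μ(B(x,r)) / log r → α` as `r ↘ 0`. The positivity of the mass of balls says that `x` lies in
the support of `μ`; off the support the local dimension is infinite, and the convention
`Real.log 0 = 0` must not turn it into `0`. -/
def HasLocalDim (μ : Measure ℝ) (x α : ℝ) : Prop :=
  (∀ r : ℝ, 0 < r → 0 < μ (Metric.ball x r)) ∧
    Tendsto (fun r : ℝ => Real.log (μ.real (Metric.ball x r)) / Real.log r) (𝓝[>] 0) (𝓝 α)

/-- The level set `Δ_μ(α)` of points at which `μ` has local dimension `α`. -/
def localDimLevelSet (μ : Measure ℝ) (α : ℝ) : Set ℝ :=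
  {x | HasLocalDim μ x α}

end

/-! Put `H(p,q) = -q log p - (1-q) log (1-p)` (`crossEntropy`). By the law of large numbers, for
almost every digit sequence `i` under the Bernoulli measure with parameter `q`, the `p`-mass of the
`n`-th cylinder around `i` is `exp(-n (H(p,q) + o(1)))`. If overlaps do no harm, the `p`-biased
convolution has local dimension `H(p,q) / |log lam|` at the projection of `i`. One inequality is
free, since a ball contains a cylinder of comparable size.

The other needs few sequences to project close to `i`, and holds for almost every `lam` by
transversality: the parameters at which two sequences that first differ at index `n` have `r`-close
projections form a set of measure `O(r lam^(-n))` (`exists_volume_close_le`). Integrating ball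
masses over `lam` then gives `O(r^s)` for every positive `s < H(p,q) / |log lam|`, as long as this
ratio is below `1` (`exists_nhds_ae_frostmanBound`). Transversality follows by compactness from the
absence of double zeros in `(1/2, 0.66847)` of power series with coefficients in `{-1, 0, 1}` and
nonzero constant term. That is certified by an interval search evaluated in the kernel
(`chainExcludes_nodes`).

Fubini turns "for every `q`, almost every `lam`" into "for almost every `lam`, almost every `q`"
(`ae_ae_ae_frostmanBelow`). The same bound with `p` replaced by `q` makes the `q`-biased convolution
a Frostman measure carried by the level set, with exponents up to `H(q,q) / |log lam| = h(q) / |log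
lam|`; Gibbs' inequality `H(q,q) ≤ H(p,q)` keeps this ratio below `1`. Finally `α = H(p,q) / |log
lam|` is affine in `q`, so almost every `q` means almost every `α`. -/

/-! ### Power series with coefficients in `{-1, 0, 1}` have no double zeros in `(1/2, 0.66847)` -/

/-- The power series `∑ a_k x ^ k`. -/
noncomputable def seriesValue (a : ℕ → ℤ) (x : ℝ) : ℝ := ∑' k, (a k : ℝ) * x ^ k

/-- The Euler derivative `x f'(x) = ∑ k a_k x ^ k` of the power series `f = ∑ a_k x ^ k`. -/
noncomputable def seriesEuler (a : ℕ → ℤ) (x : ℝ) : ℝ := ∑' k : ℕ, (k : ℝ) * ((a k : ℝ) * x ^ k)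

theorem abs_intCast_le_one {a : ℤ} (h : |a| ≤ 1) : |(a : ℝ)| ≤ 1 := by
  rw [← Int.cast_abs]; exact_mod_cast h

section Series

variable {a : ℕ → ℤ} {x : ℝ}

theorem summable_seriesValue (ha : ∀ k, |a k| ≤ 1) (h0 : 0 < x) (h1 : x < 1) :
    Summable fun k => (a k : ℝ) * x ^ k := by
  refine Summable.of_norm_bounded (summable_geometric_of_lt_one h0.le h1) fun k => ?_
  rw [norm_mul, Real.norm_eq_abs, Real.norm_of_nonneg (by positivity)]
  exact mul_le_of_le_one_left (by positivity) (abs_intCast_le_one (ha k))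

theorem summable_natCast_mul_pow (h0 : 0 < x) (h1 : x < 1) :
    Summable fun k : ℕ => (k : ℝ) * x ^ k := by
  simpa using summable_pow_mul_geometric_of_norm_lt_one 1 (r := x)
    (by rwa [Real.norm_of_nonneg h0.le])

theorem summable_seriesEuler (ha : ∀ k, |a k| ≤ 1) (h0 : 0 < x) (h1 : x < 1) :
    Summable fun k : ℕ => (k : ℝ) * ((a k : ℝ) * x ^ k) := by
  refine Summable.of_norm_bounded (summable_natCast_mul_pow h0 h1) fun k => ?_
  rw [norm_mul, norm_mul, Real.norm_eq_abs (a k : ℝ), Real.norm_of_nonneg (by positivity),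
    Real.norm_of_nonneg (by positivity)]
  gcongr
  exact mul_le_of_le_one_left (by positivity) (abs_intCast_le_one (ha k))

theorem seriesValue_succ (ha : ∀ k, |a k| ≤ 1) (h0 : 0 < x) (h1 : x < 1) :
    seriesValue a x = a 0 + x * seriesValue (fun k => a (k + 1)) x := by
  rw [seriesValue, (summable_seriesValue ha h0 h1).tsum_eq_zero_add, seriesValue, ← tsum_mul_left]
  simp only [pow_zero, mul_one]
  congr 2 with k
  ring

/-- With the Euler derivative in place of `f'`, deleting the constant coefficient acts on the pair
(value, Euler derivative) by an affine map depending only on `x` and that coefficient. The interval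
search iterates this map. -/
theorem seriesEuler_succ (ha : ∀ k, |a k| ≤ 1) (h0 : 0 < x) (h1 : x < 1) :
    seriesEuler a x =
      x * (seriesValue (fun k => a (k + 1)) x + seriesEuler (fun k => a (k + 1)) x) := by
  have ha' : ∀ k, |a (k + 1)| ≤ 1 := fun k => ha _
  rw [seriesEuler, (summable_seriesEuler ha h0 h1).tsum_eq_zero_add, seriesValue, seriesEuler,
    ← (summable_seriesValue ha' h0 h1).tsum_add (summable_seriesEuler ha' h0 h1), ← tsum_mul_left]
  simp only [Nat.cast_zero, zero_mul, zero_add]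
  congr 1 with k
  push_cast
  ring

theorem abs_seriesValue_le (ha : ∀ k, |a k| ≤ 1) (h0 : 0 < x) (h1 : x < 1) :
    |seriesValue a x| ≤ 1 / (1 - x) := by
  rw [← Real.norm_eq_abs, one_div]
  refine tsum_of_norm_bounded (hasSum_geometric_of_lt_one h0.le h1) fun k => ?_
  rw [norm_mul, Real.norm_eq_abs, Real.norm_of_nonneg (by positivity)]
  exact mul_le_of_le_one_left (by positivity) (abs_intCast_le_one (ha k))

theorem abs_seriesEuler_le (ha : ∀ k, |a k| ≤ 1) (h0 : 0 < x) (h1 : x < 1) :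
    |seriesEuler a x| ≤ x / (1 - x) ^ 2 := by
  rw [← Real.norm_eq_abs]
  refine tsum_of_norm_bounded (hasSum_coe_mul_geometric_of_norm_lt_one
    (by rwa [Real.norm_of_nonneg h0.le])) fun k => ?_
  rw [norm_mul, norm_mul, Real.norm_eq_abs (a k : ℝ), Real.norm_of_nonneg (by positivity),
    Real.norm_of_nonneg (by positivity)]
  gcongr
  exact mul_le_of_le_one_left (by positivity) (abs_intCast_le_one (ha k))

end Series

/-! Fixed-point arithmetic with unit `10 ^ 9`. -/

/-- `a / 10 ^ 9` rounded down. -/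
def fixDown (a : ℤ) : ℤ := a / 1000000000

/-- `a / 10 ^ 9` rounded up. -/
def fixUp (a : ℤ) : ℤ := -(-a / 1000000000)

/-- `a / b` rounded up. -/
def divUp (a b : ℤ) : ℤ := -(-a / b)

theorem fixDown_le (a : ℤ) : (fixDown a : ℝ) * 1000000000 ≤ a := by
  have : fixDown a * 1000000000 ≤ a := Int.ediv_mul_le _ (by norm_num)
  exact_mod_cast this

theorem le_divUp (a : ℤ) {b : ℤ} (hb : 0 < b) : (a : ℝ) ≤ divUp a b * b := by
  have : a ≤ divUp a b * b := by
    have := Int.ediv_mul_le (-a) hb.ne'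
    rw [divUp]; linarith
  exact_mod_cast this

theorem le_fixUp (a : ℤ) : (a : ℝ) ≤ fixUp a * 1000000000 := by
  exact_mod_cast le_divUp a (b := 1000000000) (by norm_num)

/-- The sign of `h` is unknown, so either endpoint of `[yl, yr]` may give the maximum. -/
theorem mul_le_max_of_mem {z y h yl yr : ℝ} (hz : z ≤ h) (h0 : 0 ≤ yl) (hl : yl ≤ y)
    (hr : y ≤ yr) : z * y ≤ max (h * yl) (h * yr) := by
  have : z * y ≤ h * y := mul_le_mul_of_nonneg_right hz (h0.trans hl)
  rcases le_total 0 h with hh | hh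
  · exact (this.trans (mul_le_mul_of_nonneg_left hr hh)).trans (le_max_right _ _)
  · exact (this.trans (mul_le_mul_of_nonpos_left hl hh)).trans (le_max_left _ _)

theorem min_le_mul_of_mem {z y l yl yr : ℝ} (hz : l ≤ z) (h0 : 0 ≤ yl) (hl : yl ≤ y)
    (hr : y ≤ yr) : min (l * yl) (l * yr) ≤ z * y := by
  have := mul_le_max_of_mem (neg_le_neg hz) h0 hl hr
  rw [neg_mul, neg_mul, neg_mul, max_neg_neg] at this
  linarith

theorem mul_le_fixUp {z y : ℝ} {h yl yr : ℤ} (hz : z * 1000000000 ≤ h) (h0 : 0 ≤ yl)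
    (hl : (yl : ℝ) ≤ y * 1000000000) (hr : y * 1000000000 ≤ yr) :
    z * y * 1000000000 ≤ fixUp (max (h * yl) (h * yr)) := by
  have h1 := mul_le_max_of_mem hz (by exact_mod_cast h0 : (0 : ℝ) ≤ yl) hl hr
  have h2 := le_fixUp (max (h * yl) (h * yr))
  push_cast at h2
  linarith

theorem fixDown_le_mul {z y : ℝ} {l yl yr : ℤ} (hz : (l : ℝ) ≤ z * 1000000000) (h0 : 0 ≤ yl)
    (hl : (yl : ℝ) ≤ y * 1000000000) (hr : y * 1000000000 ≤ yr) :
    fixDown (min (l * yl) (l * yr)) ≤ z * y * 1000000000 := by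
  have h1 := min_le_mul_of_mem hz (by exact_mod_cast h0 : (0 : ℝ) ≤ yl) hl hr
  have h2 := fixDown_le (min (l * yl) (l * yr))
  push_cast at h2
  linarith

/-- Whether the box `[ul, uh] × [wl, wh]` is disjoint from one of the `n` strips
`|w - t' u| ≤ s_{t'}`, `t' = t, …, t + n - 1`, where `s_t = s` and `s_{t+1} = t + 1 + X s_t`. -/
def hullExcludes (X ul uh wl wh : ℤ) : ℕ → ℤ → ℤ → Bool
  | 0, _, _ => false
  | n + 1, t, s =>
    decide (s < wl - t * uh) || (decide (wh - t * ul < -s) ||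
      hullExcludes X ul uh wl wh n (t + 1) ((t + 1) * 1000000000 + fixUp (X * s)))

/-- Interval search: no power series `f` with coefficients in `{-1, 0, 1}` has
`(f(x), x f'(x))` in the box `[ul, uh] × [wl, wh]` for `1/x ∈ [yl, yr]`, when `X` bounds `x` and
`G` bounds `1 / (1 - x)`. -/
def searchExcludes (yl yr X G : ℤ) : ℕ → ℤ → ℤ → ℤ → ℤ → Bool
  | 0, _, _, _, _ => false
  | n + 1, ul, uh, wl, wh =>
    (decide (G < ul) || (decide (uh < -G) ||
      hullExcludes X ul uh wl wh 5 0 (fixUp (X * fixUp (G * G))))) ||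
    [(-1 : ℤ), 0, 1].all fun a =>
      let l := ul - a * 1000000000
      let h := uh - a * 1000000000
      let ul' := fixDown (min (l * yl) (l * yr))
      let uh' := fixUp (max (h * yl) (h * yr))
      searchExcludes yl yr X G n ul' uh' (fixDown (min (wl * yl) (wl * yr)) - uh')
        (fixUp (max (wh * yl) (wh * yr)) - ul')

/-- No power series with constant coefficient `1` and coefficients in `{-1, 0, 1}` has a double
zero at `x` with `1/x ∈ [yl, yr]`. -/
def pieceExcludes (yl yr : ℤ) : Bool :=
  let X := divUp 1000000000000000000 yl
  decide (0 < yl) && (decide (X < 1000000000) &&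
    searchExcludes yl yr X (divUp 1000000000000000000 (1000000000 - X)) 26 (-yr) (-yl) yl yr)

/-- `pieceExcludes` for all consecutive intervals of a list of nodes. -/
def chainExcludes : ℤ → List ℤ → Bool
  | _, [] => true
  | y, z :: l => pieceExcludes y z && chainExcludes z l

/-- The strips propagate by the shift: with `g`, `w` the value and Euler derivative of the shifted
series, the quantity for `t + 1` equals `-(t + 1) b₀ + x (w - t g)`, whence `s_{t+1} = t + 1 + X
s_t`. -/
theorem hullExcludes_eq_false {x : ℝ} (h0 : 0 < x) (h1 : x < 1) {X : ℤ}
    (hX : x * 1000000000 ≤ X) {a : ℕ → ℤ} (ha : ∀ k, |a k| ≤ 1) {ul uh wl wh : ℤ}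
    (hul : (ul : ℝ) ≤ seriesValue a x * 1000000000) (huh : seriesValue a x * 1000000000 ≤ uh)
    (hwl : (wl : ℝ) ≤ seriesEuler a x * 1000000000) (hwh : seriesEuler a x * 1000000000 ≤ wh)
    (n : ℕ) : ∀ t s : ℤ, 0 ≤ t → (∀ b : ℕ → ℤ, (∀ k, |b k| ≤ 1) →
      |seriesEuler b x - t * seriesValue b x| * 1000000000 ≤ s) →
      hullExcludes X ul uh wl wh n t s = false := by
  induction n with
  | zero => intros; rfl
  | succ n ih =>
    intro t s ht hs
    have htR : (0 : ℝ) ≤ t := by exact_mod_cast ht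
    have key := hs a ha
    have hk1 := le_abs_self (seriesEuler a x - t * seriesValue a x)
    have hk2 := neg_abs_le (seriesEuler a x - t * seriesValue a x)
    have e1 := mul_le_mul_of_nonneg_left hul htR
    have e2 := mul_le_mul_of_nonneg_left huh htR
    have c1 : ¬ s < wl - t * uh := by
      intro h
      have : (s : ℝ) < wl - t * uh := by exact_mod_cast h
      nlinarith
    have c2 : ¬ wh - t * ul < -s := by
      intro h
      have : (wh : ℝ) - t * ul < -s := by exact_mod_cast h
      nlinarith
    simp only [hullExcludes, c1, c2, decide_false, Bool.false_or]
    refine ih _ _ (by omega) fun b hb => ?_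
    have hb' : ∀ k, |b (k + 1)| ≤ 1 := fun k => hb _
    have hs' := hs _ hb'
    rw [seriesValue_succ hb h0 h1, seriesEuler_succ hb h0 h1]
    set g := seriesValue (fun k => b (k + 1)) x
    set w := seriesEuler (fun k => b (k + 1)) x
    have e : x * (g + w) - ((t + 1 : ℤ) : ℝ) * (b 0 + x * g)
        = -((t + 1) * b 0) + x * (w - t * g) := by push_cast; ring
    have b0 := abs_intCast_le_one (hb 0)
    have hle : |x * (g + w) - ((t + 1 : ℤ) : ℝ) * (b 0 + x * g)| ≤ (t + 1) + x * |w - t * g| := by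
      rw [e]
      refine (abs_add_le _ _).trans ?_
      rw [abs_neg, abs_mul, abs_mul, abs_of_nonneg h0.le, abs_of_nonneg (by linarith : (0:ℝ) ≤ t + 1)]
      gcongr
      nlinarith
    have hf := le_fixUp (X * s)
    push_cast at hf hle ⊢
    have hs0 : (0 : ℝ) ≤ |w - t * g| * 1000000000 := by positivity
    have : (x * 1000000000) * (|w - t * g| * 1000000000) ≤ X * s :=
      mul_le_mul hX hs' hs0 (by nlinarith)
    nlinarith

/-- An actual series survives every pruning test, and the branch following its own coefficients is
never excluded. Exhausted depth also returns `false`, so `true` is a genuine certificate. -/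
theorem searchExcludes_eq_false {x : ℝ} (h0 : 0 < x) (h1 : x < 1) {X G yl yr : ℤ}
    (hX : x * 1000000000 ≤ X) (hG : 1 / (1 - x) * 1000000000 ≤ G) (hy : 0 ≤ yl)
    (hyl : (yl : ℝ) ≤ x⁻¹ * 1000000000) (hyr : x⁻¹ * 1000000000 ≤ yr) (n : ℕ) :
    ∀ (a : ℕ → ℤ) (ul uh wl wh : ℤ), (∀ k, |a k| ≤ 1) →
      (ul : ℝ) ≤ seriesValue a x * 1000000000 → seriesValue a x * 1000000000 ≤ uh →
      (wl : ℝ) ≤ seriesEuler a x * 1000000000 → seriesEuler a x * 1000000000 ≤ wh →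
      searchExcludes yl yr X G n ul uh wl wh = false := by
  induction n with
  | zero => intros; rfl
  | succ n ih =>
    intro a ul uh wl wh ha hul huh hwl hwh
    have hx1 : 0 < 1 - x := by linarith
    have hg := abs_le.1 (abs_seriesValue_le ha h0 h1)
    have c1 : ¬ G < ul := by
      intro h
      have : (G : ℝ) < ul := by exact_mod_cast h
      linarith
    have c2 : ¬ uh < -G := by
      intro h
      have : (uh : ℝ) < -G := by exact_mod_cast h
      linarith
    have c3 : hullExcludes X ul uh wl wh 5 0 (fixUp (X * fixUp (G * G))) = false := by
      refine hullExcludes_eq_false h0 h1 hX ha hul huh hwl hwh 5 0 _ le_rfl fun b hb => ?_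
      have hb := abs_seriesEuler_le hb h0 h1
      have f1 := le_fixUp (X * fixUp (G * G))
      have f2 := le_fixUp (G * G)
      push_cast at f1 f2 ⊢
      rw [zero_mul, sub_zero]
      have p1 : (0 : ℝ) < 1 / (1 - x) * 1000000000 := by positivity
      have g1 : (1 / (1 - x) * 1000000000) * (1 / (1 - x) * 1000000000) ≤ (G : ℝ) * G :=
        mul_le_mul hG hG p1.le (p1.le.trans hG)
      have g2 : (1 / (1 - x)) * (1 / (1 - x)) * 1000000000 ≤ (fixUp (G * G) : ℝ) := by linarith
      have g3 : (x * 1000000000) * ((1 / (1 - x)) * (1 / (1 - x)) * 1000000000)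
          ≤ (X : ℝ) * fixUp (G * G) :=
        mul_le_mul hX g2 (by positivity) ((by positivity : 0 ≤ x * 1000000000).trans hX)
      have g4 : x / (1 - x) ^ 2 = x * ((1 / (1 - x)) * (1 / (1 - x))) := by field_simp
      rw [g4] at hb
      linarith
    simp only [searchExcludes, c1, c2, c3, decide_false, Bool.false_or]
    have ha' : ∀ k, |a (k + 1)| ≤ 1 := fun k => ha _
    set a' : ℕ → ℤ := fun k => a (k + 1) with ha'_def
    -- The shift recursion solved for the tail; it expands by `x⁻¹`, so boxes that contain no actual
    -- series tend to leave the bounded hull.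
    have v : seriesValue a' x = (seriesValue a x - a 0) * x⁻¹ := by
      rw [seriesValue_succ ha h0 h1]; field_simp; ring
    have w : seriesEuler a' x = seriesEuler a x * x⁻¹ - seriesValue a' x := by
      rw [seriesEuler_succ ha h0 h1]; field_simp; ring
    have u1 := fixDown_le_mul (z := seriesValue a x - a 0) (y := x⁻¹) (l := ul - a 0 * 1000000000)
      (by push_cast; linarith) hy hyl hyr
    have u2 := mul_le_fixUp (z := seriesValue a x - a 0) (y := x⁻¹) (h := uh - a 0 * 1000000000)
      (by push_cast; linarith) hy hyl hyr
    have u3 := fixDown_le_mul hwl hy hyl hyr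
    have u4 := mul_le_fixUp hwh hy hyl hyr
    rw [← v] at u1 u2
    have main := ih a' _ _ (fixDown (min (wl * yl) (wl * yr)) -
      fixUp (max ((uh - a 0 * 1000000000) * yl) ((uh - a 0 * 1000000000) * yr)))
      (fixUp (max (wh * yl) (wh * yr)) -
      fixDown (min ((ul - a 0 * 1000000000) * yl) ((ul - a 0 * 1000000000) * yr))) ha' u1 u2
      (by push_cast; rw [w]; linarith) (by push_cast; rw [w]; linarith)
    have h3 : a 0 = -1 ∨ a 0 = 0 ∨ a 0 = 1 := by have := abs_le.1 (ha 0); omega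
    rw [List.all_eq_false]
    refine ⟨a 0, ?_, ?_⟩
    · rcases h3 with h | h | h <;> simp [h]
    · simpa using main

/-- A double zero with constant coefficient `1` forces the tail to have value `-x⁻¹` and Euler
derivative `x⁻¹`; this is the initial box of the search. -/
theorem not_doubleZero_of_pieceExcludes {yl yr : ℤ} (h : pieceExcludes yl yr = true) {x : ℝ}
    (h0 : 0 < x) (hyl : (yl : ℝ) ≤ x⁻¹ * 1000000000) (hyr : x⁻¹ * 1000000000 ≤ yr) {a : ℕ → ℤ}
    (ha : ∀ k, |a k| ≤ 1) (ha0 : a 0 = 1) (hv : seriesValue a x = 0) (he : seriesEuler a x = 0) :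
    False := by
  simp only [pieceExcludes, Bool.and_eq_true, decide_eq_true_eq] at h
  obtain ⟨hy, hX1, hs⟩ := h
  set X := divUp 1000000000000000000 yl with hX_def
  have hyR : (0 : ℝ) < yl := by exact_mod_cast hy
  have hX : x * 1000000000 ≤ X := by
    have h2 := le_divUp 1000000000000000000 hy
    rw [← hX_def] at h2
    push_cast at h2
    have h3 : x * yl ≤ 1000000000 := by
      calc x * yl ≤ x * (x⁻¹ * 1000000000) := by gcongr
        _ = 1000000000 := by field_simp
    by_contra hc
    push Not at hc
    nlinarith
  have hX1R : (X : ℝ) < 1000000000 := by exact_mod_cast hX1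
  have h1 : x < 1 := by linarith
  have hx1 : 0 < 1 - x := by linarith
  have hG : 1 / (1 - x) * 1000000000 ≤ divUp 1000000000000000000 (1000000000 - X) := by
    have hd : 0 < 1000000000 - X := by omega
    have h2 := le_divUp 1000000000000000000 hd
    have hdR : (0 : ℝ) < 1000000000 - X := by linarith
    push_cast at h2
    rw [div_mul_eq_mul_div, div_le_iff₀ hx1]
    have hpos : (0 : ℝ) ≤ divUp 1000000000000000000 (1000000000 - X) := by
      by_contra hc
      push Not at hc
      nlinarith
    nlinarith
  have ha' : ∀ k, |a (k + 1)| ≤ 1 := fun k => ha _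
  have v : seriesValue (fun k => a (k + 1)) x = -x⁻¹ := by
    have := seriesValue_succ ha h0 h1
    rw [hv, ha0] at this
    push_cast at this
    field_simp
    linarith
  have w : seriesEuler (fun k => a (k + 1)) x = x⁻¹ := by
    have := seriesEuler_succ ha h0 h1
    rw [he, v, eq_comm, mul_eq_zero] at this
    rcases this with h | h <;> linarith
  have := searchExcludes_eq_false h0 h1 hX hG hy.le hyl hyr 26 (fun k => a (k + 1)) (-yr) (-yl) yl
    yr ha' (by rw [v]; push_cast; linarith) (by rw [v]; push_cast; linarith) (by rwa [w])
    (by rwa [w])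
  rw [this] at hs
  exact absurd hs (by simp)

/-- The conclusion is phrased so that it is the hypothesis itself for the empty list; it contradicts
a strict lower bound `y` on the scaled inverse. -/
theorem not_doubleZero_of_chainExcludes {x : ℝ} (h0 : 0 < x) {a : ℕ → ℤ}
    (ha : ∀ k, |a k| ≤ 1) (ha0 : a 0 = 1) (hv : seriesValue a x = 0) (he : seriesEuler a x = 0)
    (l : List ℤ) : ∀ y : ℤ, chainExcludes y l = true → (y : ℝ) ≤ x⁻¹ * 1000000000 →
      x⁻¹ * 1000000000 ≤ ((l.getLastD y : ℤ) : ℝ) → x⁻¹ * 1000000000 ≤ y := by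
  induction l with
  | nil => intro y _ _ h; simpa using h
  | cons z l ih =>
    intro y h hy hl
    simp only [chainExcludes, Bool.and_eq_true] at h
    rcases le_total (x⁻¹ * 1000000000) z with hz | hz
    · exact (not_doubleZero_of_pieceExcludes h.1 h0 hy hz ha ha0 hv he).elim
    · have hz' := ih z h.2 hz (by rwa [List.getLastD_cons] at hl)
      exact (not_doubleZero_of_pieceExcludes h.1 h0 hy hz' ha ha0 hv he).elim

/-- The nodes cover `1/x` from `1/0.66847`, rounded down, to `2`. The spacing grows away from
`1/0.66847`. -/
theorem chainExcludes_nodes : chainExcludes 1495953445 [1495954445, 1495956445, 1495960445,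
    1495964445, 1495972445, 1495980445, 1495996445, 1496012445, 1496044445, 1496076445, 1496140445,
    1496204445, 1496268445, 1496396445, 1496524445, 1496780445, 1497036445, 1497548445, 1498060445,
    1499084445, 1501132445, 1503180445, 1507276445, 1511372445, 1519564445, 1535948445, 1552332445,
    1585100445, 1650636445, 1781708445, 2000000000] = true := by
  decide +kernel

theorem not_doubleZero_of_mem_Ioo {x : ℝ} (hx : x ∈ Ioo (1 / 2 : ℝ) 0.66847) {a : ℕ → ℤ}
    (ha : ∀ k, |a k| ≤ 1) (ha0 : a 0 ≠ 0) (hv : seriesValue a x = 0) (he : seriesEuler a x = 0) :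
    False := by
  have h0 : 0 < x := by linarith [hx.1]
  have main : ∀ b : ℕ → ℤ, (∀ k, |b k| ≤ 1) → b 0 = 1 → seriesValue b x = 0 →
      seriesEuler b x = 0 → False := by
    intro b hb hb0 hv he
    have l1 : (1495953445 : ℝ) < x⁻¹ * 1000000000 := by
      rw [inv_mul_eq_div, lt_div_iff₀ h0]
      have := hx.2
      norm_num at this ⊢
      linarith
    have l2 : x⁻¹ * 1000000000 ≤ 2000000000 := by
      rw [inv_mul_eq_div, div_le_iff₀ h0]
      linarith [hx.1]
    have := not_doubleZero_of_chainExcludes h0 hb hb0 hv he _ _ chainExcludes_nodes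
      (by push_cast; exact l1.le) (by simpa using l2)
    push_cast at this
    linarith
  have h3 : a 0 = -1 ∨ a 0 = 1 := by have := abs_le.1 (ha 0); omega
  rcases h3 with h | h
  · refine main (fun k => -a k) (fun k => by simpa using ha k) (by simp [h]) ?_ ?_
    · simpa [seriesValue, tsum_neg] using hv
    · simpa [seriesEuler, tsum_neg] using he
  · exact main a ha h hv he

/-! ### Transversality -/

/-- The difference quotient of the power series `∑ a_k x ^ k`, extended to the diagonal. -/
noncomputable def seriesSlope (a : ℕ → ℤ) (x y : ℝ) : ℝ :=
  ∑' k : ℕ, (a k : ℝ) * ∑ m ∈ Finset.range k, x ^ m * y ^ (k - 1 - m)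

theorem norm_slopeTerm_le {a : ℤ} (ha : |a| ≤ 1) {x y b : ℝ} (hx : x ∈ Icc 0 b)
    (hy : y ∈ Icc 0 b) (k : ℕ) :
    ‖(a : ℝ) * ∑ m ∈ Finset.range k, x ^ m * y ^ (k - 1 - m)‖ ≤ k * b ^ (k - 1) := by
  have h0 : 0 ≤ ∑ m ∈ Finset.range k, x ^ m * y ^ (k - 1 - m) :=
    Finset.sum_nonneg fun m _ => mul_nonneg (pow_nonneg hx.1 _) (pow_nonneg hy.1 _)
  rw [norm_mul, Real.norm_eq_abs, Real.norm_of_nonneg h0]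
  refine (mul_le_of_le_one_left h0 (abs_intCast_le_one ha)).trans ?_
  have : ∀ m ∈ Finset.range k, x ^ m * y ^ (k - 1 - m) ≤ b ^ (k - 1) := fun m hm => by
    have hm' := Finset.mem_range.1 hm
    calc x ^ m * y ^ (k - 1 - m) ≤ b ^ m * b ^ (k - 1 - m) := by
          gcongr
          exacts [pow_nonneg hy.1 _, pow_nonneg (hx.1.trans hx.2) _, hx.1, hx.2, hy.1, hy.2]
      _ = b ^ (k - 1) := by rw [← pow_add]; congr 1; omega
  simpa using Finset.sum_le_sum this

theorem summable_natCast_mul_pow_pred {b : ℝ} (h0 : 0 < b) (h1 : b < 1) :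
    Summable fun k : ℕ => (k : ℝ) * b ^ (k - 1) := by
  refine ((summable_natCast_mul_pow h0 h1).mul_left b⁻¹).congr fun k => ?_
  rcases k with _ | k
  · simp
  · rw [Nat.add_sub_cancel, pow_succ]; field_simp

theorem sub_mul_seriesSlope {a : ℕ → ℤ} (ha : ∀ k, |a k| ≤ 1) {x y : ℝ} (hx : x ∈ Ioo (0 : ℝ) 1)
    (hy : y ∈ Ioo (0 : ℝ) 1) :
    (x - y) * seriesSlope a x y = seriesValue a x - seriesValue a y := by
  rw [seriesValue, seriesValue, ← (summable_seriesValue ha hx.1 hx.2).tsum_sub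
    (summable_seriesValue ha hy.1 hy.2), seriesSlope, ← tsum_mul_left]
  congr 1 with k
  rw [← mul_sub, ← geom_sum₂_mul]
  ring

/-- On the diagonal the slope is the derivative, so simultaneous vanishing of value and slope is a
double zero. -/
theorem mul_seriesSlope_self (a : ℕ → ℤ) (x : ℝ) :
    x * seriesSlope a x x = seriesEuler a x := by
  rw [seriesSlope, ← tsum_mul_left, seriesEuler]
  congr 1 with k
  rcases k with _ | k
  · simp
  · have : ∀ m ∈ Finset.range (k + 1), x ^ m * x ^ (k + 1 - 1 - m) = x ^ k := fun m hm => by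
      have := Finset.mem_range.1 hm
      rw [← pow_add]; congr 1; omega
    rw [Finset.sum_congr rfl this]
    simp
    ring

/-- The difference of two digit sequences. -/
def digitDiff (i j : ℕ → Fin 2) (k : ℕ) : ℤ := ((i k : ℕ) : ℤ) - ((j k : ℕ) : ℤ)

theorem abs_digitDiff_le (i j : ℕ → Fin 2) (k : ℕ) : |digitDiff i j k| ≤ 1 := by
  have := (i k).isLt
  have := (j k).isLt
  rw [digitDiff, abs_le]
  omega

theorem continuous_digitDiff (k : ℕ) :
    Continuous fun z : (ℕ → Fin 2) × (ℕ → Fin 2) => (digitDiff z.1 z.2 k : ℝ) := by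
  have h : Continuous fun d : Fin 2 × Fin 2 => (((d.1 : ℕ) : ℤ) - ((d.2 : ℕ) : ℤ) : ℤ) :=
    continuous_of_discreteTopology
  have h2 : Continuous fun z : (ℕ → Fin 2) × (ℕ → Fin 2) => (z.1 k, z.2 k) := by fun_prop
  exact (continuous_of_discreteTopology (f := fun n : ℤ => (n : ℝ))).comp (h.comp h2)

/-- Projection of the real line to `[0, 7/10]`. -/
noncomputable def clip (x : ℝ) : ℝ := max 0 (min x (7 / 10))

theorem continuous_clip : Continuous clip := by unfold clip; fun_prop

theorem clip_mem (x : ℝ) : clip x ∈ Icc (0 : ℝ) (7 / 10) :=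
  ⟨le_max_left _ _, max_le (by norm_num) (min_le_right _ _)⟩

theorem clip_of_mem {x : ℝ} (hx : x ∈ Icc (0 : ℝ) (7 / 10)) : clip x = x := by
  rw [clip, min_eq_left hx.2, max_eq_right hx.1]

/-- Clipping to `[0, 7/10]`, which contains all relevant parameters, gives the M-test a uniform
geometric majorant and hence joint continuity on the whole space. -/
theorem continuous_seriesValue_clip :
    Continuous fun z : ((ℕ → Fin 2) × (ℕ → Fin 2)) × (ℝ × ℝ) =>
      seriesValue (digitDiff z.1.1 z.1.2) (clip z.2.1) := by
  refine continuous_tsum (u := fun k => (7 / 10 : ℝ) ^ k) (fun k => ?_)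
    (summable_geometric_of_lt_one (by norm_num) (by norm_num)) fun k z => ?_
  · exact ((continuous_digitDiff k).comp continuous_fst).mul
      ((continuous_clip.comp (continuous_fst.comp continuous_snd)).pow k)
  · have hc := clip_mem z.2.1
    rw [norm_mul, Real.norm_eq_abs, Real.norm_of_nonneg (pow_nonneg hc.1 k)]
    exact (mul_le_of_le_one_left (pow_nonneg hc.1 k)
      (abs_intCast_le_one (abs_digitDiff_le _ _ k))).trans (pow_le_pow_left₀ hc.1 hc.2 k)

theorem continuous_seriesSlope_clip :
    Continuous fun z : ((ℕ → Fin 2) × (ℕ → Fin 2)) × (ℝ × ℝ) =>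
      seriesSlope (digitDiff z.1.1 z.1.2) (clip z.2.1) (clip z.2.2) := by
  refine continuous_tsum (fun k => ?_)
    (summable_natCast_mul_pow_pred (b := 7 / 10) (by norm_num) (by norm_num)) fun k z =>
      norm_slopeTerm_le (abs_digitDiff_le _ _ k) (clip_mem _) (clip_mem _) k
  refine ((continuous_digitDiff k).comp continuous_fst).mul
    (continuous_finsetSum _ fun m _ => ?_)
  exact ((continuous_clip.comp (continuous_fst.comp continuous_snd)).pow m).mul
      ((continuous_clip.comp (continuous_snd.comp continuous_snd)).pow _)

/-- Value and slope do not vanish together at `(x₀, x₀)`. Compactness of the pairs with distinct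
first digits gives a uniform lower bound for `Φ` nearby, so small values force a large slope, and
`|x - y|` is controlled by the difference of the values. -/
theorem exists_transversality {x₀ : ℝ} (hx₀ : x₀ ∈ Ioo (1 / 2 : ℝ) 0.66847) :
    ∃ ε > 0, ∃ C > 0, ∀ i j : ℕ → Fin 2, i 0 ≠ j 0 →
      ∀ x ∈ Ioo (x₀ - ε) (x₀ + ε), ∀ y ∈ Ioo (x₀ - ε) (x₀ + ε), ∀ ρ : ℝ,
        |seriesValue (digitDiff i j) x| < ρ → |seriesValue (digitDiff i j) y| < ρ →
          |x - y| ≤ C * ρ := by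
  have h7 : (0.66847 : ℝ) < 7 / 10 := by norm_num
  let Φ : ((ℕ → Fin 2) × (ℕ → Fin 2)) × (ℝ × ℝ) → ℝ := fun z =>
    |seriesValue (digitDiff z.1.1 z.1.2) (clip z.2.1)| +
      |seriesSlope (digitDiff z.1.1 z.1.2) (clip z.2.1) (clip z.2.2)|
  have hΦ : Continuous Φ := continuous_seriesValue_clip.abs.add continuous_seriesSlope_clip.abs
  let K : Set ((ℕ → Fin 2) × (ℕ → Fin 2)) := {z | z.1 0 ≠ z.2 0}
  have hK : IsCompact K := by
    refine IsClosed.isCompact ?_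
    have h : Continuous fun z : (ℕ → Fin 2) × (ℕ → Fin 2) => (z.1 0, z.2 0) := by fun_prop
    exact (isClosed_discrete {d : Fin 2 × Fin 2 | d.1 ≠ d.2}).preimage h
  have hpos : K ×ˢ {(x₀, x₀)} ⊆ {z | 0 < Φ z} := by
    rintro ⟨⟨i, j⟩, p⟩ ⟨hij, hp⟩
    obtain rfl : p = (x₀, x₀) := hp
    have hc : clip x₀ = x₀ := clip_of_mem ⟨by linarith [hx₀.1], by linarith [hx₀.2]⟩
    show 0 < Φ ((i, j), (x₀, x₀))
    by_contra hn
    have hz : Φ ((i, j), (x₀, x₀)) = 0 :=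
      le_antisymm (not_lt.1 hn) (add_nonneg (abs_nonneg _) (abs_nonneg _))
    simp only [Φ, hc] at hz
    rw [add_eq_zero_iff_of_nonneg (abs_nonneg _) (abs_nonneg _), abs_eq_zero, abs_eq_zero] at hz
    refine not_doubleZero_of_mem_Ioo hx₀ (abs_digitDiff_le i j) ?_ hz.1
      (by rw [← mul_seriesSlope_self, hz.2, mul_zero])
    intro h
    apply hij
    rw [digitDiff, sub_eq_zero] at h
    exact Fin.ext (by exact_mod_cast h)
  obtain ⟨u, v, -, hv, hu, hxv, huv⟩ := generalized_tube_lemma hK isCompact_singleton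
    (isOpen_lt continuous_const hΦ) hpos
  obtain ⟨ε₁, hε₁, hball⟩ := Metric.isOpen_iff.1 hv (x₀, x₀) (hxv rfl)
  obtain ⟨ε, hε0, hε⟩ : ∃ ε > 0, ε < ε₁ ∧ ε < x₀ ∧ ε < 7 / 10 - x₀ := by
    have : 0 < min ε₁ (min x₀ (7 / 10 - x₀)) :=
      lt_min hε₁ (lt_min (by linarith [hx₀.1]) (by linarith [hx₀.2]))
    refine ⟨min ε₁ (min x₀ (7 / 10 - x₀)) / 2, by positivity, ?_⟩
    have h := half_lt_self this
    exact ⟨h.trans_le (min_le_left _ _),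
      h.trans_le ((min_le_right _ _).trans (min_le_left _ _)),
      h.trans_le ((min_le_right _ _).trans (min_le_right _ _))⟩
  let B : Set (ℝ × ℝ) := Metric.closedBall (x₀, x₀) ε
  have hB : IsCompact B := isCompact_closedBall _ _
  have hKne : (K ×ˢ B).Nonempty := by
    refine ⟨((fun _ => 0, fun _ => 1), (x₀, x₀)), ?_, Metric.mem_closedBall_self hε0.le⟩
    show (0 : Fin 2) ≠ 1
    decide
  obtain ⟨z₀, hz₀, hmin⟩ := (hK.prod hB).exists_isMinOn hKne hΦ.continuousOn
  have hδ : 0 < Φ z₀ := huv ⟨hu hz₀.1, hball (Metric.closedBall_subset_ball hε.1 hz₀.2)⟩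
  set δ := Φ z₀ / 2 with hδ_def
  have hδ0 : 0 < δ := by positivity
  refine ⟨ε, hε0, max (2 / δ) (2 * ε / δ), by positivity, fun i j hij x hx y hy ρ hfx hfy => ?_⟩
  have hρ : 0 < ρ := (abs_nonneg _).trans_lt hfx
  -- For large `ρ` the length `2 ε` of the interval suffices. For `ρ ≤ δ` the value is below half
  -- the minimum of `Φ`, so the slope is at least `δ`.
  rcases lt_or_ge δ ρ with h | h
  · have h1 : |x - y| ≤ 2 * ε := by
      rw [abs_le]; constructor <;> linarith [hx.1, hx.2, hy.1, hy.2]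
    calc |x - y| ≤ 2 * ε / δ * δ := by rwa [div_mul_cancel₀ _ hδ0.ne']
      _ ≤ max (2 / δ) (2 * ε / δ) * ρ := by gcongr; exact le_max_right _ _
  · have hx' : x ∈ Ioo (0 : ℝ) (7 / 10) := ⟨by linarith [hx.1], by linarith [hx.2]⟩
    have hy' : y ∈ Ioo (0 : ℝ) (7 / 10) := ⟨by linarith [hy.1], by linarith [hy.2]⟩
    have hmem : ((i, j), (x, y)) ∈ K ×ˢ B := by
      refine ⟨hij, ?_⟩
      rw [Metric.mem_closedBall, Prod.dist_eq, max_le_iff, Real.dist_eq, Real.dist_eq, abs_le,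
        abs_le]
      refine ⟨⟨?_, ?_⟩, ?_, ?_⟩ <;> simp only <;> linarith [hx.1, hx.2, hy.1, hy.2]
    have hm : Φ z₀ ≤ Φ ((i, j), (x, y)) := hmin hmem
    simp only [Φ, clip_of_mem (Ioo_subset_Icc_self hx'), clip_of_mem (Ioo_subset_Icc_self hy')] at hm
    have hs : δ ≤ |seriesSlope (digitDiff i j) x y| := by
      have : Φ z₀ = 2 * δ := by rw [hδ_def]; ring
      linarith
    have heq := sub_mul_seriesSlope (abs_digitDiff_le i j) (x := x) (y := y)
      ⟨hx'.1, by linarith [hx'.2]⟩ ⟨hy'.1, by linarith [hy'.2]⟩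
    have h2 : |x - y| * δ ≤ 2 * ρ := by
      calc |x - y| * δ ≤ |x - y| * |seriesSlope (digitDiff i j) x y| := by gcongr
        _ = |seriesValue (digitDiff i j) x - seriesValue (digitDiff i j) y| := by
          rw [← abs_mul, heq]
        _ ≤ 2 * ρ := by
          refine (abs_sub _ _).trans ?_
          linarith
    calc |x - y| ≤ 2 / δ * ρ := by
          rw [div_mul_eq_mul_div, le_div_iff₀ hδ0]; exact h2
      _ ≤ max (2 / δ) (2 * ε / δ) * ρ := by gcongr; exact le_max_left _ _

/-! ### The natural projection -/

theorem summable_natProj {lam : ℝ} (h0 : 0 < lam) (h1 : lam < 1) (i : ℕ → Fin 2) :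
    Summable fun n : ℕ => ((i n : ℕ) : ℝ) * lam ^ (n + 1) := by
  refine Summable.of_norm_bounded ((summable_geometric_of_lt_one h0.le h1).mul_right lam)
    fun n => ?_
  rw [Real.norm_of_nonneg (by positivity), pow_succ]
  refine mul_le_of_le_one_left (by positivity) ?_
  have := (i n).isLt
  exact_mod_cast (by omega : (i n : ℕ) ≤ 1)

theorem natProj_sub_natProj {lam : ℝ} (h0 : 0 < lam) (h1 : lam < 1) {i j : ℕ → Fin 2} {n : ℕ}
    (h : ∀ k < n, i k = j k) :
    natProj lam i - natProj lam j = lam ^ (n + 1) *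
      seriesValue (digitDiff (fun k => i (n + k)) fun k => j (n + k)) lam := by
  rw [natProj, natProj, ← (summable_natProj h0 h1 i).tsum_sub (summable_natProj h0 h1 j),
    ← ((summable_natProj h0 h1 i).sub (summable_natProj h0 h1 j)).sum_add_tsum_nat_add n,
    Finset.sum_eq_zero fun k hk => by rw [h k (Finset.mem_range.1 hk), sub_self], zero_add,
    seriesValue, ← tsum_mul_left]
  congr 1 with k
  rw [digitDiff, add_comm n k]
  push_cast
  ring

theorem abs_natProj_sub_natProj_le {lam : ℝ} (h0 : 0 < lam) (h1 : lam < 1) {i j : ℕ → Fin 2}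
    {n : ℕ} (h : ∀ k < n, i k = j k) :
    |natProj lam i - natProj lam j| ≤ lam ^ (n + 1) / (1 - lam) := by
  rw [natProj_sub_natProj h0 h1 h, abs_mul, abs_of_nonneg (by positivity), div_eq_mul_one_div]
  gcongr
  exact abs_seriesValue_le (abs_digitDiff_le _ _) h0 h1

/-- Near every parameter of `(1/2, 0.66847)`, the set of parameters at which the projections of two
sequences are `r`-close is small. -/
theorem exists_volume_close_le {x₀ : ℝ} (hx₀ : x₀ ∈ Ioo (1 / 2 : ℝ) 0.66847) :
    ∃ ε > 0, x₀ + ε ≤ 7 / 10 ∧ ∃ C > 0, ∀ lam₀ ∈ Ioo (1 / 2 : ℝ) x₀, ∀ (n : ℕ) (i j : ℕ → Fin 2),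
      (∀ k < n, i k = j k) → i n ≠ j n → ∀ r : ℝ,
        volume {x | x ∈ Ioo (max lam₀ (x₀ - ε)) (x₀ + ε) ∧ |natProj x i - natProj x j| < r} ≤
          ENNReal.ofReal (C * (r * (lam₀ ^ (n + 1))⁻¹)) := by
  obtain ⟨ε₀, hε₀, C, hC, H⟩ := exists_transversality hx₀
  refine ⟨min ε₀ (7 / 10 - x₀), lt_min hε₀ (by have := hx₀.2; norm_num at this; linarith),
    by linarith [min_le_right ε₀ (7 / 10 - x₀)], C, hC,
    fun lam₀ hlam₀ n i j hij hne r => ?_⟩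
  -- The difference of projections is `z ^ (n + 1)` times a series with nonzero constant term, and
  -- `z > lam₀`. Transversality with `ρ = r / lam₀ ^ (n + 1)` bounds the diameter, hence the volume.
  refine (Real.volume_le_diam _).trans (Metric.ediam_le fun x hx y hy => ?_)
  have aux : ∀ z ∈ {x | x ∈ Ioo (max lam₀ (x₀ - min ε₀ (7 / 10 - x₀))) (x₀ + min ε₀ (7 / 10 - x₀)) ∧
      |natProj x i - natProj x j| < r}, z ∈ Ioo (x₀ - ε₀) (x₀ + ε₀) ∧
      |seriesValue (digitDiff (fun k => i (n + k)) fun k => j (n + k)) z| <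
        r * (lam₀ ^ (n + 1))⁻¹ := by
    rintro z ⟨hz, hzr⟩
    have m1 := min_le_left ε₀ (7 / 10 - x₀)
    have m2 := min_le_right ε₀ (7 / 10 - x₀)
    have z1 : lam₀ < z := (le_max_left _ _).trans_lt hz.1
    have z2 : x₀ - min ε₀ (7 / 10 - x₀) < z := (le_max_right _ _).trans_lt hz.1
    have z0 : 0 < lam₀ := by linarith [hlam₀.1]
    refine ⟨⟨by linarith, by linarith [hz.2]⟩, ?_⟩
    rw [natProj_sub_natProj (z0.trans z1) (by linarith [hz.2]) hij, abs_mul,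
      abs_of_nonneg (pow_nonneg (z0.trans z1).le _)] at hzr
    rw [← div_eq_mul_inv, lt_div_iff₀ (by positivity), mul_comm]
    refine lt_of_le_of_lt ?_ hzr
    gcongr
  rw [edist_dist, Real.dist_eq]
  exact ENNReal.ofReal_le_ofReal (H _ _ (by simpa using hne) x (aux x hx).1 y (aux y hy).1 _
    (aux x hx).2 (aux y hy).2)

/-! ### Cylinders and the masses of balls -/

theorem fin_two_val_continuous (k : ℕ) :
    Continuous fun i : ℕ → Fin 2 => (((i k : ℕ)) : ℝ) :=
  (continuous_of_discreteTopology (f := fun d : Fin 2 => ((d : ℕ) : ℝ))).comp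
    (continuous_apply k)

theorem continuous_natProj_clip :
    Continuous fun z : ℝ × (ℕ → Fin 2) => natProj (clip z.1) z.2 := by
  refine continuous_tsum (u := fun k => (7 / 10 : ℝ) ^ (k + 1)) (fun k => ?_)
    ((summable_nat_add_iff 1).2 (summable_geometric_of_lt_one (by norm_num) (by norm_num)))
    fun k z => ?_
  · exact ((fin_two_val_continuous k).comp continuous_snd).mul
      ((continuous_clip.comp continuous_fst).pow _)
  · have hc := clip_mem z.1
    rw [Real.norm_of_nonneg (mul_nonneg (Nat.cast_nonneg _) (pow_nonneg hc.1 _))]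
    refine (mul_le_of_le_one_left (pow_nonneg hc.1 _) ?_).trans (pow_le_pow_left₀ hc.1 hc.2 _)
    have := (z.2 k).isLt
    exact_mod_cast (by omega : (z.2 k : ℕ) ≤ 1)

instance (p : unitInterval) : IsProbabilityMeasure (symbolicBernoulli p) := by
  unfold symbolicBernoulli; infer_instance

/-- The mass of a digit under the Bernoulli measure. -/
noncomputable def digitWeight (p : unitInterval) (d : Fin 2) : ℝ :=
  if d = 0 then (p : ℝ) else 1 - p

/-- The mass of the `n`-th cylinder around `i`. -/
noncomputable def wordWeight (p : unitInterval) (i : ℕ → Fin 2) (n : ℕ) : ℝ :=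
  ∏ k ∈ Finset.range n, digitWeight p (i k)

/-- The sequences whose first `n` digits agree with those of `i`. -/
def cylinderAt (i : ℕ → Fin 2) (n : ℕ) : Set (ℕ → Fin 2) := {j | ∀ k < n, i k = j k}

theorem cylinderAt_eq_pi (i : ℕ → Fin 2) (n : ℕ) :
    cylinderAt i n = Set.pi (Finset.range n : Set ℕ) fun k => {i k} := by
  ext j
  simp [cylinderAt, Set.mem_pi, eq_comm]

theorem measurableSet_cylinderAt (i : ℕ → Fin 2) (n : ℕ) : MeasurableSet (cylinderAt i n) := by
  rw [cylinderAt_eq_pi]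
  exact MeasurableSet.pi (Finset.range n).countable_toSet fun _ _ => measurableSet_singleton _

theorem digitWeight_nonneg (p : unitInterval) (d : Fin 2) : 0 ≤ digitWeight p d := by
  unfold digitWeight
  split_ifs
  exacts [p.2.1, by linarith [p.2.2]]

theorem digitWeight_le_one (p : unitInterval) (d : Fin 2) : digitWeight p d ≤ 1 := by
  unfold digitWeight
  split_ifs
  exacts [p.2.2, by linarith [p.2.1]]

theorem digitWeight_pos {p : unitInterval} (h0 : 0 < (p : ℝ)) (h1 : (p : ℝ) < 1) (d : Fin 2) :
    0 < digitWeight p d := by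
  unfold digitWeight
  split_ifs
  exacts [h0, by linarith]

theorem wordWeight_nonneg (p : unitInterval) (i : ℕ → Fin 2) (n : ℕ) : 0 ≤ wordWeight p i n :=
  Finset.prod_nonneg fun _ _ => digitWeight_nonneg _ _

theorem wordWeight_le_one (p : unitInterval) (i : ℕ → Fin 2) (n : ℕ) : wordWeight p i n ≤ 1 :=
  Finset.prod_le_one (fun _ _ => digitWeight_nonneg _ _) fun _ _ => digitWeight_le_one _ _

theorem wordWeight_pos {p : unitInterval} (h0 : 0 < (p : ℝ)) (h1 : (p : ℝ) < 1) (i : ℕ → Fin 2)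
    (n : ℕ) : 0 < wordWeight p i n :=
  Finset.prod_pos fun _ _ => digitWeight_pos h0 h1 _

theorem bernoulliMeasure_singleton (p : unitInterval) (d : Fin 2) :
    ProbabilityTheory.bernoulliMeasure (0 : Fin 2) 1 p {d} = ENNReal.ofReal (digitWeight p d) := by
  rw [← ENNReal.ofReal_toReal (measure_ne_top _ {d}), ← measureReal_def,
    ProbabilityTheory.bernoulliMeasure_real_apply p (measurableSet_singleton d)]
  congr 1
  fin_cases d <;> simp [digitWeight]

theorem symbolicBernoulli_cylinderAt (p : unitInterval) (i : ℕ → Fin 2) (n : ℕ) :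
    symbolicBernoulli p (cylinderAt i n) = ENNReal.ofReal (wordWeight p i n) := by
  rw [cylinderAt_eq_pi, symbolicBernoulli,
    Measure.infinitePi_pi _ fun _ _ => measurableSet_singleton _, wordWeight,
    ENNReal.ofReal_prod_of_nonneg fun _ _ => digitWeight_nonneg _ _]
  simp_rw [bernoulliMeasure_singleton]

/-! ### Ball masses averaged over the parameter, and Frostman bounds. -/

/-- The mass under `symbolicBernoulli p` of the sequences with projection `r`-close to that of
`i`, at the parameter `x` (clipped to `[0, 7/10]`). -/
noncomputable def ballMass (p : unitInterval) (x : ℝ) (i : ℕ → Fin 2) (r : ℝ) : ENNReal :=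
  symbolicBernoulli p {j | |natProj (clip x) i - natProj (clip x) j| < r}

theorem measurableSet_natProj_close (i : ℕ → Fin 2) (r : ℝ) :
    MeasurableSet {z : ℝ × (ℕ → Fin 2) | |natProj (clip z.1) i - natProj (clip z.1) z.2| < r} := by
  refine (isOpen_lt ?_ continuous_const).measurableSet
  have h : Continuous fun z : ℝ × (ℕ → Fin 2) => natProj (clip z.1) i :=
    continuous_natProj_clip.comp (continuous_fst.prodMk continuous_const)
  exact (h.sub continuous_natProj_clip).abs

theorem measurable_ballMass_param (p : unitInterval) (i : ℕ → Fin 2) (r : ℝ) :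
    Measurable fun x => ballMass p x i r :=
  measurable_measure_prodMk_left (measurableSet_natProj_close i r)

/-- By Fubini, integrate over the second sequence `j` the measure of the parameters that bring it
close to `i`. Sort `j` by its first disagreement with `i`: below `N` transversality applies,
otherwise the whole interval is counted. -/
theorem exists_lintegral_ballMass_le {x₀ : ℝ} (hx₀ : x₀ ∈ Ioo (1 / 2 : ℝ) 0.66847) :
    ∃ ε > 0, ∃ C > 0, ∀ lam₀ ∈ Ioo (1 / 2 : ℝ) x₀, ∀ (p : unitInterval) (i : ℕ → Fin 2) (r : ℝ),
      0 < r → ∀ N : ℕ,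
        ∫⁻ x in Ioo (max lam₀ (x₀ - ε)) (x₀ + ε), ballMass p x i r ≤
          ENNReal.ofReal (2 * ε * wordWeight p i N +
            ∑ n ∈ Finset.range N, C * (r * (lam₀ ^ (n + 1))⁻¹) * wordWeight p i n) := by
  obtain ⟨ε, hε, hε7, C, hC, H⟩ := exists_volume_close_le hx₀
  refine ⟨ε, hε, C, hC, fun lam₀ hlam₀ p i r hr N => ?_⟩
  set J := Ioo (max lam₀ (x₀ - ε)) (x₀ + ε) with hJ
  have hl0 : 0 < lam₀ := by linarith [hlam₀.1]
  have hclip : ∀ x ∈ J, clip x = x := fun x hx => clip_of_mem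
    ⟨by linarith [(le_max_left _ _).trans_lt hx.1], by linarith [hx.2]⟩
  have hvJ : volume J ≤ ENNReal.ofReal (2 * ε) := by
    rw [hJ, Real.volume_Ioo]
    exact ENNReal.ofReal_le_ofReal (by linarith [le_max_right lam₀ (x₀ - ε)])
  set S := {z : ℝ × (ℕ → Fin 2) | |natProj (clip z.1) i - natProj (clip z.1) z.2| < r} with hS
  have hSm : MeasurableSet S := measurableSet_natProj_close i r
  have e1 : ∫⁻ x in J, ballMass p x i r =
      ∫⁻ j, volume.restrict J ((fun x => (x, j)) ⁻¹' S) ∂symbolicBernoulli p := by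
    rw [← Measure.prod_apply_symm hSm, Measure.prod_apply hSm]
    rfl
  set c : ℕ → ENNReal := fun n => ENNReal.ofReal (C * (r * (lam₀ ^ (n + 1))⁻¹)) with hc
  have e2 : ∀ j, volume.restrict J ((fun x => (x, j)) ⁻¹' S) ≤
      (cylinderAt i N).indicator (fun _ => ENNReal.ofReal (2 * ε)) j +
        ∑ n ∈ Finset.range N, (cylinderAt i n).indicator (fun _ => c n) j := by
    intro j
    by_cases hj : j ∈ cylinderAt i N
    · rw [indicator_of_mem hj]
      refine le_trans ?_ (le_add_right le_rfl)
      refine (measure_mono (subset_univ _)).trans ?_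
      rwa [Measure.restrict_apply_univ]
    · refine le_trans ?_ (le_add_left le_rfl)
      have hex : ∃ n, i n ≠ j n := by
        by_contra hn
        push Not at hn
        exact hj fun k _ => hn k
      classical
      set n := Nat.find hex with hn
      have hlt : ∀ k < n, i k = j k := fun k hk => not_not.1 (Nat.find_min hex hk)
      have hnN : n < N := by
        by_contra hn'
        exact hj fun k hk => hlt k (by omega)
      have hterm : volume.restrict J ((fun x => (x, j)) ⁻¹' S) ≤
          (cylinderAt i n).indicator (fun _ => c n) j := by
        rw [indicator_of_mem (show j ∈ cylinderAt i n from hlt)]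
        refine le_trans ?_ (H lam₀ hlam₀ n i j hlt (Nat.find_spec hex) r)
        rw [Measure.restrict_apply (hSm.preimage (by fun_prop))]
        refine measure_mono fun x hx => ⟨hx.2, ?_⟩
        have := hx.1
        simp only [hS, mem_preimage, mem_ofPred_eq, hclip x hx.2] at this
        exact this
      exact hterm.trans (Finset.single_le_sum
        (f := fun n => (cylinderAt i n).indicator (fun _ => c n) j)
        (fun _ _ => zero_le) (Finset.mem_range.2 hnN))
  rw [e1]
  refine (lintegral_mono e2).trans (le_of_eq ?_)
  rw [lintegral_add_left (measurable_const.indicator (measurableSet_cylinderAt i N)),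
    lintegral_finsetSum _ fun n _ => measurable_const.indicator (measurableSet_cylinderAt i n),
    lintegral_indicator_const (measurableSet_cylinderAt i N), symbolicBernoulli_cylinderAt,
    ENNReal.ofReal_add (by have := wordWeight_nonneg p i N; positivity)
      (Finset.sum_nonneg fun n _ => by have := wordWeight_nonneg p i n; positivity),
    ENNReal.ofReal_mul (p := 2 * ε) (by positivity), ENNReal.ofReal_sum_of_nonneg
      fun n _ => by have := wordWeight_nonneg p i n; positivity]
  congr 1
  refine Finset.sum_congr rfl fun n _ => ?_
  rw [lintegral_indicator_const (measurableSet_cylinderAt i n), symbolicBernoulli_cylinderAt,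
    ENNReal.ofReal_mul (p := C * _) (by positivity)]

/-- Summation of the geometric bounds of `exists_lintegral_ballMass_le`, at the level `N` for which
`lam₀ ^ N` is comparable to `r`. -/
theorem exists_sum_le_rpow {lam₀ s C ε K : ℝ} (h0 : 0 < lam₀) (h1 : lam₀ < 1) (hs0 : 0 ≤ s)
    (hs1 : s < 1) (hC : 0 < C) (hε : 0 < ε) (hK : 0 ≤ K) {w : ℕ → ℝ}
    (hw : ∀ n, w n ≤ K * (lam₀ ^ s) ^ n) :
    ∃ M, ∀ r, 0 < r → r ≤ 1 → ∃ N : ℕ,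
      2 * ε * w N + ∑ n ∈ Finset.range N, C * (r * (lam₀ ^ (n + 1))⁻¹) * w n ≤ M * r ^ s := by
  set ρ := lam₀ ^ s with hρ
  have hρ0 : 0 < ρ := Real.rpow_pos_of_pos h0 s
  set τ := ρ / lam₀ with hτ
  -- Here `τ = lam₀ ^ (s - 1)`; since `s < 1`, the geometric sum is dominated by its last term.
  have hτ1 : 1 < τ := by
    rw [hτ, one_lt_div h0, hρ]
    simpa using Real.rpow_lt_rpow_of_exponent_gt h0 h1 hs1
  have hτ0 : 0 < τ - 1 := by linarith
  refine ⟨2 * ε * K + C * K * lam₀⁻¹ * (τ / (τ - 1)) * ρ⁻¹, fun r hr hr1 => ?_⟩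
  obtain ⟨m, hm1, hm2⟩ := exists_nat_pow_near_of_lt_one hr hr1 h0 h1
  refine ⟨m + 1, ?_⟩
  have hρr : ρ ^ (m + 1) ≤ r ^ s := by
    rw [hρ, ← Real.rpow_natCast, ← Real.rpow_mul h0.le, mul_comm, Real.rpow_mul h0.le,
      Real.rpow_natCast]
    exact Real.rpow_le_rpow (by positivity) hm1.le hs0
  have b1 : 2 * ε * w (m + 1) ≤ 2 * ε * K * r ^ s := by
    calc 2 * ε * w (m + 1) ≤ 2 * ε * (K * ρ ^ (m + 1)) := by gcongr; exact hw _
      _ ≤ 2 * ε * (K * r ^ s) := by gcongr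
      _ = 2 * ε * K * r ^ s := by ring
  have b2 : ∑ n ∈ Finset.range (m + 1), C * (r * (lam₀ ^ (n + 1))⁻¹) * w n ≤
      C * K * lam₀⁻¹ * (τ / (τ - 1)) * ρ⁻¹ * r ^ s := by
    calc ∑ n ∈ Finset.range (m + 1), C * (r * (lam₀ ^ (n + 1))⁻¹) * w n
        ≤ ∑ n ∈ Finset.range (m + 1), C * r * K * lam₀⁻¹ * τ ^ n := by
          refine Finset.sum_le_sum fun n _ => ?_
          calc C * (r * (lam₀ ^ (n + 1))⁻¹) * w n
              ≤ C * (r * (lam₀ ^ (n + 1))⁻¹) * (K * ρ ^ n) := by gcongr; exact hw n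
            _ = C * r * K * lam₀⁻¹ * τ ^ n := by
              rw [hτ, div_pow, pow_succ]; field_simp
      _ = C * r * K * lam₀⁻¹ * ((τ ^ (m + 1) - 1) / (τ - 1)) := by
          rw [← Finset.mul_sum, geom_sum_eq hτ1.ne']
      _ ≤ C * r * K * lam₀⁻¹ * (τ ^ (m + 1) / (τ - 1)) := by gcongr; linarith
      _ = C * K * lam₀⁻¹ * (τ / (τ - 1)) * ρ⁻¹ * (r * (lam₀ ^ m)⁻¹ * ρ ^ (m + 1)) := by
          rw [pow_succ τ, pow_succ ρ, hτ, div_pow]; field_simp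
      _ ≤ C * K * lam₀⁻¹ * (τ / (τ - 1)) * ρ⁻¹ * (1 * r ^ s) := by
          gcongr
          rw [← div_eq_mul_inv]
          exact div_le_one_of_le₀ hm2 (by positivity)
      _ = _ := by rw [one_mul]
  rw [add_mul]
  exact add_le_add b1 b2

/-- A power bound with exponent `s` for the masses of the dyadic balls around the projection of
`i`. -/
def FrostmanBound (p : unitInterval) (x : ℝ) (i : ℕ → Fin 2) (s : ℝ) : Prop :=
  ∃ K : ℕ, ∀ n : ℕ, ballMass p x i ((1 / 2) ^ n) ≤ ENNReal.ofReal (K * ((1 / 2 : ℝ) ^ n) ^ s)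

/-- Weighted by `r ^ (-s)`, the integrals at `r = 2 ^ (-n)` decay like `2 ^ (-n (s' - s))`. Their
sum is finite, so the weighted masses are summable, hence bounded, for almost every `x`. -/
theorem ae_frostmanBound_of_lintegral_le {p : unitInterval} {i : ℕ → Fin 2} {J : Set ℝ}
    {M s s' : ℝ} (hss : s < s') (hM : ∀ r, 0 < r → r ≤ 1 →
      ∫⁻ x in J, ballMass p x i r ≤ ENNReal.ofReal (M * r ^ s')) :
    ∀ᵐ x ∂volume.restrict J, FrostmanBound p x i s := by
  set c : ℕ → ENNReal := fun n => ENNReal.ofReal (((1 / 2 : ℝ) ^ n) ^ (-s)) with hc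
  have hmeas : ∀ n, Measurable fun x => c n * ballMass p x i ((1 / 2) ^ n) := fun n =>
    (measurable_ballMass_param p i _).const_mul _
  have hfin : ∫⁻ x in J, ∑' n, c n * ballMass p x i ((1 / 2) ^ n) ≠ ⊤ := by
    rw [lintegral_tsum fun n => (hmeas n).aemeasurable]
    have hb : ∀ n, ∫⁻ x in J, c n * ballMass p x i ((1 / 2) ^ n) ≤
        ENNReal.ofReal (M * ((1 / 2 : ℝ) ^ (s' - s)) ^ n) := fun n => by
      rw [lintegral_const_mul _ (measurable_ballMass_param p i _)]
      refine (mul_le_mul_right (hM ((1 / 2) ^ n) (by positivity)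
        (pow_le_one₀ (by norm_num) (by norm_num))) _).trans_eq ?_
      rw [hc, ← ENNReal.ofReal_mul (by positivity)]
      congr 1
      rw [← Real.rpow_natCast (((1 / 2 : ℝ) ^ (s' - s))), ← Real.rpow_mul (by norm_num),
        mul_comm (s' - s), Real.rpow_mul (by norm_num), Real.rpow_natCast,
        sub_eq_add_neg, Real.rpow_add (by positivity)]
      ring
    refine ne_top_of_le_ne_top ?_ (ENNReal.tsum_le_tsum hb)
    refine Summable.tsum_ofReal_ne_top ((summable_geometric_of_lt_one (by positivity) ?_).mul_left M)
    exact Real.rpow_lt_one (by norm_num) (by norm_num) (by linarith)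
  filter_upwards [ae_lt_top (Measurable.tsum hmeas) hfin] with x hx
  obtain ⟨K, hK⟩ := ENNReal.exists_nat_gt hx.ne
  refine ⟨K, fun n => ?_⟩
  have h1 : c n * ballMass p x i ((1 / 2) ^ n) ≤ K :=
    (ENNReal.le_tsum n).trans hK.le
  have hcn : c n * ENNReal.ofReal (((1 / 2 : ℝ) ^ n) ^ s) = 1 := by
    rw [hc, ← ENNReal.ofReal_mul (by positivity), ← Real.rpow_add (by positivity)]
    simp
  calc ballMass p x i ((1 / 2) ^ n)
      = (c n * ballMass p x i ((1 / 2) ^ n)) * ENNReal.ofReal (((1 / 2 : ℝ) ^ n) ^ s) := by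
        rw [mul_right_comm, hcn, one_mul]
    _ ≤ K * ENNReal.ofReal (((1 / 2 : ℝ) ^ n) ^ s) := by gcongr
    _ = _ := by rw [ENNReal.ofReal_mul (by positivity), ENNReal.ofReal_natCast]

/-- The cross entropy of the Bernoulli measure with parameter `q` relative to that with
parameter `p`. -/
noncomputable def crossEntropy (p q : ℝ) : ℝ :=
  -(q * Real.log p + (1 - q) * Real.log (1 - p))

/-- The masses of the cylinders around `i` decay at the rate `crossEntropy p q`. -/
def IsTypical (p q : unitInterval) (i : ℕ → Fin 2) : Prop :=
  Tendsto (fun n : ℕ => Real.log (wordWeight p i n) / n) atTop (𝓝 (-crossEntropy p q))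

theorem exists_wordWeight_le {p q : unitInterval} (hp0 : 0 < (p : ℝ)) (hp1 : (p : ℝ) < 1)
    {i : ℕ → Fin 2} (hi : IsTypical p q i) {ρ : ℝ} (hρ0 : 0 < ρ) (hρ1 : ρ < 1)
    (hρ : -Real.log ρ < crossEntropy p q) :
    ∃ K, 0 ≤ K ∧ ∀ n, wordWeight p i n ≤ K * ρ ^ n := by
  have hev : ∀ᶠ n : ℕ in atTop, Real.log (wordWeight p i n) / n < Real.log ρ :=
    hi.eventually_lt_const (by linarith)
  obtain ⟨N, hN⟩ := eventually_atTop.1 (hev.and (eventually_ge_atTop 1))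
  refine ⟨(ρ ^ N)⁻¹, by positivity, fun n => ?_⟩
  rcases le_total N n with h | h
  · obtain ⟨h1, h2⟩ := hN n h
    have hn : (0 : ℝ) < n := by exact_mod_cast h2
    rw [div_lt_iff₀ hn, mul_comm, ← Real.log_pow] at h1
    have h3 := ((Real.log_lt_log_iff (wordWeight_pos hp0 hp1 i n) (by positivity)).1 h1).le
    refine h3.trans (le_mul_of_one_le_left (by positivity) ?_)
    exact (one_le_inv₀ (by positivity)).2 (pow_le_one₀ hρ0.le hρ1.le)
  · refine (wordWeight_le_one p i n).trans ?_
    rw [inv_mul_eq_div, one_le_div (by positivity)]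
    exact pow_le_pow_of_le_one hρ0.le hρ1.le h

theorem exists_nhds_ae_frostmanBound {p q : unitInterval} (hp0 : 0 < (p : ℝ)) (hp1 : (p : ℝ) < 1)
    {i : ℕ → Fin 2} (hi : IsTypical p q i) {x₀ : ℝ} (hx₀ : x₀ ∈ Ioo (1 / 2 : ℝ) 0.66847) {s : ℝ}
    (hs0 : 0 < s) (hs : s * -Real.log x₀ < crossEntropy p q)
    (hx : crossEntropy p q < -Real.log x₀) :
    ∃ U ∈ 𝓝 x₀, ∀ᵐ x ∂volume.restrict U, FrostmanBound p x i s := by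
  have hx0 : 0 < x₀ := by linarith [hx₀.1]
  have hx1 : x₀ < 1 := by have := hx₀.2; norm_num at this; linarith
  have hL : 0 < -Real.log x₀ := by linarith [Real.log_neg hx0 hx1]
  -- Room is needed twice: `s'` above `s` for summability over dyadic radii, and `lam₀` below `x₀`
  -- so that `x₀` is interior to the parameter interval.
  obtain ⟨s', hs1, hs2⟩ := exists_between ((lt_div_iff₀ hL).2 hs)
  rw [lt_div_iff₀ hL] at hs2
  have hs'1 : s' < 1 := by
    by_contra h
    push Not at h
    nlinarith
  have hcont : Tendsto (fun y => s' * -Real.log y) (𝓝[<] x₀) (𝓝 (s' * -Real.log x₀)) :=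
    (((Real.continuousAt_log hx0.ne').neg.const_mul s').tendsto).mono_left nhdsWithin_le_nhds
  obtain ⟨lam₀, hl1, hl2, hl3⟩ := ((hcont.eventually_lt_const hs2).and
    (Ioo_mem_nhdsLT hx₀.1)).exists
  have hl0 : 0 < lam₀ := by linarith
  have hl11 : lam₀ < 1 := by linarith
  obtain ⟨K, hK, hw⟩ := exists_wordWeight_le hp0 hp1 hi (Real.rpow_pos_of_pos hl0 s')
    (Real.rpow_lt_one hl0.le hl11 (by linarith)) (by rw [Real.log_rpow hl0]; linarith)
  obtain ⟨ε, hε, C, hC, H⟩ := exists_lintegral_ballMass_le hx₀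
  obtain ⟨M, hM⟩ := exists_sum_le_rpow hl0 hl11 (by linarith) hs'1 hC hε hK hw
  refine ⟨Ioo (max lam₀ (x₀ - ε)) (x₀ + ε), Ioo_mem_nhds (max_lt hl3 (by linarith)) (by linarith),
    ae_frostmanBound_of_lintegral_le (M := M) hs1 fun r hr hr1 => ?_⟩
  obtain ⟨N, hN⟩ := hM r hr hr1
  exact (H lam₀ ⟨hl2, hl3⟩ p i r hr N).trans (ENNReal.ofReal_le_ofReal hN)

/-- At the parameter `x`, the ball masses around the projection of `i` satisfy power bounds with all
exponents below `crossEntropy p q / |log x|`, provided this is less than `1`. -/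
def FrostmanBelow (p q : unitInterval) (x : ℝ) (i : ℕ → Fin 2) : Prop :=
  x ∈ Ioo (1 / 2 : ℝ) 0.66847 → crossEntropy p q < -Real.log x →
    ∀ s : ℚ, (0 : ℝ) < s → s * -Real.log x < crossEntropy p q → FrostmanBound p x i s

theorem ae_frostmanBelow {p q : unitInterval} (hp0 : 0 < (p : ℝ)) (hp1 : (p : ℝ) < 1)
    {i : ℕ → Fin 2} (hi : IsTypical p q i) : ∀ᵐ x, FrostmanBelow p q x i := by
  have key : ∀ s : ℚ, ∀ᵐ x : ℝ, x ∈ Ioo (1 / 2 : ℝ) 0.66847 → crossEntropy p q < -Real.log x →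
      (0 : ℝ) < s → s * -Real.log x < crossEntropy p q → FrostmanBound p x i s := by
    intro s
    rw [ae_iff]
    -- The exceptional set is null near each of its points, hence null.
    refine measure_null_of_locally_null _ fun x₀ hx₀ => ?_
    simp only [mem_ofPred_eq, not_forall] at hx₀
    obtain ⟨h1, h2, h3, h4, -⟩ := hx₀
    obtain ⟨U, hU, hae⟩ := exists_nhds_ae_frostmanBound hp0 hp1 hi h1 h3 h4 h2
    obtain ⟨V, hVU, hVo, hxV⟩ := mem_nhds_iff.1 hU
    refine ⟨_, inter_mem_nhdsWithin _ (hVo.mem_nhds hxV), ?_⟩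
    have hae' := (ae_restrict_iff' hVo.measurableSet).1 (ae_restrict_of_ae_restrict_of_subset hVU hae)
    refine measure_mono_null (fun x hx => ?_) (ae_iff.1 hae')
    simp only [mem_inter_iff, mem_ofPred_eq, not_forall] at hx ⊢
    obtain ⟨⟨_, _, _, _, h⟩, hxV⟩ := hx
    exact ⟨hxV, h⟩
  filter_upwards [ae_all_iff.2 key] with x hx h1 h2 s h3 h4
  exact hx s h1 h2 h3 h4

/-! ### Typical sequences and Fubini -/

theorem bernoulliMeasure_map_eval (q : unitInterval) (k : ℕ) :
    (symbolicBernoulli q).map (fun i => i k) =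
      ProbabilityTheory.bernoulliMeasure (0 : Fin 2) 1 q :=
  (measurePreserving_eval_infinitePi _ k).map_eq

/-- The strong law of large numbers for the log-weights of the digits, whose `q`-mean is minus the
cross entropy. -/
theorem ae_isTypical {p : unitInterval} (hp0 : 0 < (p : ℝ)) (hp1 : (p : ℝ) < 1)
    (q : unitInterval) : ∀ᵐ i ∂symbolicBernoulli q, IsTypical p q i := by
  set φ : Fin 2 → ℝ := fun d => Real.log (digitWeight p d) with hφ
  have hφm : Measurable φ := measurable_from_top
  have hev : ∀ k : ℕ, Measurable fun i : ℕ → Fin 2 => i k := fun k => measurable_pi_apply k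
  have hind : ProbabilityTheory.iIndepFun (fun (k : ℕ) (i : ℕ → Fin 2) => φ (i k))
      (symbolicBernoulli q) :=
    ProbabilityTheory.iIndepFun_infinitePi (X := fun _ => φ) fun _ => hφm
  have hident : ∀ k : ℕ, ProbabilityTheory.IdentDistrib (fun i : ℕ → Fin 2 => φ (i k))
      (fun i => φ (i 0)) (symbolicBernoulli q) (symbolicBernoulli q) := fun k => by
    refine ProbabilityTheory.IdentDistrib.comp (u := φ) ⟨(hev k).aemeasurable, (hev 0).aemeasurable,
      ?_⟩ hφm
    rw [bernoulliMeasure_map_eval, bernoulliMeasure_map_eval]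
  have hint : Integrable (fun i : ℕ → Fin 2 => φ (i 0)) (symbolicBernoulli q) :=
    Integrable.of_bound (hφm.comp (hev 0)).aestronglyMeasurable (max ‖φ 0‖ ‖φ 1‖)
      (ae_of_all _ fun i => by
        rcases Fin.exists_fin_two.1 ⟨i 0, rfl⟩ with h | h <;> rw [← h] <;> simp)
  have hval : ∫ i, φ (i 0) ∂symbolicBernoulli q = -crossEntropy p q := by
    rw [← integral_map (hev 0).aemeasurable hφm.aestronglyMeasurable (f := φ),
      bernoulliMeasure_map_eval, ProbabilityTheory.integral_bernoulliMeasure]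
    simp [hφ, digitWeight, crossEntropy]
  have := ProbabilityTheory.strong_law_ae_real (fun (k : ℕ) (i : ℕ → Fin 2) => φ (i k)) hint
    (fun a b hab => hind.indepFun hab) hident
  rw [hval] at this
  filter_upwards [this] with i hi
  refine hi.congr fun n => ?_
  rw [wordWeight, Real.log_prod fun k _ => (digitWeight_pos hp0 hp1 _).ne']

/-! ### Measurable dependence on the parameters and exchange of quantifiers. -/

theorem measurable_bernoulliMeasure_apply (t : Set (Fin 2)) :
    Measurable fun p : unitInterval => ProbabilityTheory.bernoulliMeasure (0 : Fin 2) 1 p t := by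
  have h : ∀ p : unitInterval, ProbabilityTheory.bernoulliMeasure (0 : Fin 2) 1 p t =
      ∑ d : Fin 2, t.indicator (fun d => ENNReal.ofReal (digitWeight p d)) d := fun p => by
    classical
    have ht : t = ((Finset.univ.filter (· ∈ t) : Finset (Fin 2)) : Set (Fin 2)) := by ext; simp
    conv_lhs => rw [ht, ← sum_measure_singleton]
    simp_rw [bernoulliMeasure_singleton]
    rw [Finset.sum_filter]
    simp [indicator_apply]
  simp_rw [h]
  refine Finset.measurable_sum _ fun d _ => ?_
  by_cases hd : d ∈ t
  · simp only [indicator_of_mem hd]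
    refine ENNReal.measurable_ofReal.comp ?_
    unfold digitWeight
    split_ifs
    exacts [measurable_subtype_coe, measurable_const.sub measurable_subtype_coe]
  · simp only [indicator_of_notMem hd]
    exact measurable_const

theorem measurable_symbolicBernoulli : Measurable symbolicBernoulli := by
  refine Measurable.measure_of_isPiSystem_of_isProbabilityMeasure
    (generateFrom_squareCylinders (α := fun _ : ℕ => Fin 2)).symm
    (isPiSystem_squareCylinders (fun _ => MeasurableSpace.isPiSystem_measurableSet)
      fun _ => by simp) ?_
  rintro S hS
  simp only [squareCylinders, mem_ofPred_eq] at hS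
  obtain ⟨s, t, ht, rfl⟩ := hS
  have : ∀ p, symbolicBernoulli p ((s : Set ℕ).pi t) =
      ∏ k ∈ s, ProbabilityTheory.bernoulliMeasure (0 : Fin 2) 1 p (t k) := fun p =>
    Measure.infinitePi_pi _ fun k _ => ht k (mem_univ k)
  simp_rw [this]
  exact Finset.measurable_prod _ fun k _ => measurable_bernoulliMeasure_apply _

/-- The Bernoulli measures as a Markov kernel in the parameter. -/
noncomputable def bernoulliKernel : ProbabilityTheory.Kernel unitInterval (ℕ → Fin 2) :=
  ⟨symbolicBernoulli, measurable_symbolicBernoulli⟩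

instance : ProbabilityTheory.IsMarkovKernel bernoulliKernel :=
  ⟨fun p => inferInstanceAs (IsProbabilityMeasure (symbolicBernoulli p))⟩

theorem measurable_ballMass (r : ℝ) :
    Measurable fun z : unitInterval × ℝ × (ℕ → Fin 2) => ballMass z.1 z.2.1 z.2.2 r := by
  have hS : MeasurableSet {w : (unitInterval × ℝ × (ℕ → Fin 2)) × (ℕ → Fin 2) |
      |natProj (clip w.1.2.1) w.1.2.2 - natProj (clip w.1.2.1) w.2| < r} := by
    refine (isOpen_lt (Continuous.abs (Continuous.sub ?_ ?_)) continuous_const).measurableSet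
    · exact continuous_natProj_clip.comp
        ((by fun_prop : Continuous fun w : (unitInterval × ℝ × (ℕ → Fin 2)) × (ℕ → Fin 2) =>
          (w.1.2.1, w.1.2.2)))
    · exact continuous_natProj_clip.comp
        ((by fun_prop : Continuous fun w : (unitInterval × ℝ × (ℕ → Fin 2)) × (ℕ → Fin 2) =>
          (w.1.2.1, w.2)))
  exact ProbabilityTheory.Kernel.measurable_kernel_prodMk_left
    (κ := bernoulliKernel.comap Prod.fst measurable_fst) hS

theorem measurable_crossEntropy :
    Measurable fun z : unitInterval × unitInterval => crossEntropy z.1 z.2 := by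
  unfold crossEntropy
  fun_prop

/-- Rational exponents, dyadic radii and integer constants keep every quantifier countable. -/
theorem measurableSet_frostmanBelow {f : unitInterval → unitInterval} (hf : Measurable f) :
    MeasurableSet {z : (unitInterval × (ℕ → Fin 2)) × ℝ |
      FrostmanBelow (f z.1.1) z.1.1 z.2 z.1.2} := by
  have hce : Measurable fun z : (unitInterval × (ℕ → Fin 2)) × ℝ =>
      crossEntropy (f z.1.1) z.1.1 :=
    measurable_crossEntropy.comp (g := fun z : unitInterval × unitInterval => crossEntropy z.1 z.2)
      (f := fun z : (unitInterval × (ℕ → Fin 2)) × ℝ => (f z.1.1, z.1.1)) (by fun_prop)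
  have hlog : Measurable fun z : (unitInterval × (ℕ → Fin 2)) × ℝ => -Real.log z.2 := by fun_prop
  refine measurableSet_setOfPred.2 ?_
  unfold FrostmanBelow FrostmanBound
  refine Measurable.imp (measurableSet_setOfPred.1 (measurableSet_Ioo.preimage measurable_snd)) ?_
  refine Measurable.imp (measurableSet_setOfPred.1 (measurableSet_lt hce hlog)) ?_
  refine Measurable.forall fun s => Measurable.imp measurable_const ?_
  refine Measurable.imp (measurableSet_setOfPred.1 (measurableSet_lt (hlog.const_mul _) hce)) ?_
  refine Measurable.exists fun K => Measurable.forall fun n => ?_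
  refine measurableSet_setOfPred.1 (measurableSet_le ?_ measurable_const)
  exact (measurable_ballMass ((1 / 2) ^ n)).comp
    (g := fun z : unitInterval × ℝ × (ℕ → Fin 2) => ballMass z.1 z.2.1 z.2.2 ((1 / 2) ^ n))
    (f := fun z : (unitInterval × (ℕ → Fin 2)) × ℝ => (f z.1.1, z.2, z.1.2)) (by fun_prop)

/-- The constant `f = p` serves the local dimension, and `f = id` the Frostman property of the
`q`-biased measure. -/
theorem ae_ae_ae_frostmanBelow {f : unitInterval → unitInterval} (hf : Measurable f)
    (hf' : ∀ᵐ q : unitInterval, 0 < (f q : ℝ) ∧ (f q : ℝ) < 1) :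
    ∀ᵐ x : ℝ, ∀ᵐ q : unitInterval, ∀ᵐ i ∂symbolicBernoulli q, FrostmanBelow (f q) q x i := by
  have hm := measurableSet_frostmanBelow hf
  have h1 : ∀ᵐ z ∂((volume : Measure unitInterval).compProd bernoulliKernel),
      ∀ᵐ x : ℝ, FrostmanBelow (f z.1) z.1 x z.2 := by
    refine Measure.ae_compProd_of_ae_ae ?_ ?_
    · have := measurable_measure_prodMk_left (ν := (volume : Measure ℝ)) hm.compl
      exact this (measurableSet_singleton 0)
    · filter_upwards [hf'] with q hq
      filter_upwards [ae_isTypical hq.1 hq.2 q] with i hi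
      exact ae_frostmanBelow hq.1 hq.2 hi
  have h2 := (Measure.ae_ae_comm (p := fun (z : unitInterval × (ℕ → Fin 2)) (x : ℝ) =>
    FrostmanBelow (f z.1) z.1 x z.2) hm).1 h1
  filter_upwards [h2] with x hx
  exact Measure.ae_ae_of_ae_compProd hx

/-! ### Local dimensions -/

section LocalDim

variable {p q : unitInterval} {x : ℝ} {i : ℕ → Fin 2}

theorem measurable_natProj (hx : x ∈ Icc (0 : ℝ) (7 / 10)) : Measurable (natProj x) := by
  have h : Continuous fun i => natProj (clip x) i :=
    continuous_natProj_clip.comp (continuous_const.prodMk continuous_id)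
  rw [clip_of_mem hx] at h
  exact h.measurable

theorem bernoulliConvolution_ball (hx : x ∈ Icc (0 : ℝ) (7 / 10)) (p : unitInterval)
    (i : ℕ → Fin 2) (r : ℝ) :
    bernoulliConvolution x p (Metric.ball (natProj x i) r) = ballMass p x i r := by
  rw [bernoulliConvolution, Measure.map_apply (measurable_natProj hx) measurableSet_ball, ballMass,
    clip_of_mem hx]
  congr 1 with j
  simp only [mem_preimage, Metric.mem_ball, Real.dist_eq, mem_ofPred_eq, abs_sub_comm]

theorem ballMass_mono {r r' : ℝ} (h : r ≤ r') : ballMass p x i r ≤ ballMass p x i r' :=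
  measure_mono fun _ hj => lt_of_lt_of_le hj h

theorem wordWeight_le_ballMass (hx0 : 0 < x) (hx : x ≤ 7 / 10) {n : ℕ} {r : ℝ}
    (hn : x ^ (n + 1) / (1 - x) < r) :
    ENNReal.ofReal (wordWeight p i n) ≤ ballMass p x i r := by
  rw [← symbolicBernoulli_cylinderAt]
  refine measure_mono fun j hj => ?_
  simp only [mem_ofPred_eq, clip_of_mem ⟨hx0.le, hx⟩]
  exact (abs_natProj_sub_natProj_le hx0 (by linarith) hj).trans_lt hn

theorem ballMass_le_of_dyadic {s : ℝ} (hs : 0 ≤ s) {K : ℕ}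
    (hK : ∀ n : ℕ, ballMass p x i ((1 / 2) ^ n) ≤ ENNReal.ofReal (K * ((1 / 2 : ℝ) ^ n) ^ s))
    {r : ℝ} (hr : 0 < r) (hr1 : r ≤ 1) :
    ballMass p x i r ≤ ENNReal.ofReal (K * (2 * r) ^ s) := by
  obtain ⟨n, hn1, hn2⟩ := exists_nat_pow_near_of_lt_one hr hr1 (y := (1 / 2 : ℝ)) (by norm_num)
    (by norm_num)
  refine (ballMass_mono hn2).trans ((hK n).trans (ENNReal.ofReal_le_ofReal ?_))
  gcongr
  rw [pow_succ] at hn1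
  linarith

theorem tendsto_log_ballMass_div_log (hp0 : 0 < (p : ℝ)) (hp1 : (p : ℝ) < 1)
    (hx : x ∈ Ioo (1 / 2 : ℝ) 0.66847) (hi : IsTypical p q i) (hF : FrostmanBelow p q x i)
    (hc : crossEntropy p q < -Real.log x) (hc0 : 0 < crossEntropy p q) :
    Tendsto (fun r => Real.log (ballMass p x i r).toReal / Real.log r) (𝓝[>] 0)
      (𝓝 (crossEntropy p q / -Real.log x)) := by
  have hx0 : 0 < x := by linarith [hx.1]
  have hx7 : x ≤ 7 / 10 := by have := hx.2; norm_num at this; linarith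
  have hx1 : 0 < 1 - x := by linarith
  set A := crossEntropy p q with hA
  set L := -Real.log x with hLdef
  have hL : 0 < L := by linarith [Real.log_neg hx0 (by linarith)]
  have hlow : ∀ n r, x ^ (n + 1) < (1 - x) * r →
      wordWeight p i n ≤ (ballMass p x i r).toReal := fun n r h => by
    have := wordWeight_le_ballMass (p := p) (i := i) hx0 hx7 (n := n) (r := r)
      (by rwa [div_lt_iff₀' hx1])
    exact (ENNReal.ofReal_le_iff_le_toReal (measure_ne_top _ _)).1 this
  have hnear : ∀ r, 0 < r → r ≤ 1 → ∃ n : ℕ, x ^ (n + 1) < (1 - x) * r ∧ (1 - x) * r ≤ x ^ n :=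
    fun r h0 h1 => exists_nat_pow_near_of_lt_one (by positivity)
      (mul_le_one₀ (by linarith) h0.le h1) hx0 (by linarith)
  have hmpos : ∀ r, 0 < r → r ≤ 1 → 0 < (ballMass p x i r).toReal := fun r h0 h1 => by
    obtain ⟨n, hn, -⟩ := hnear r h0 h1
    exact (wordWeight_pos hp0 hp1 i n).trans_le (hlow n r hn)
  have hlog := Real.tendsto_log_nhdsGT_zero
  have hconst : ∀ a b : ℝ, Tendsto (fun r => a + b / Real.log r) (𝓝[>] 0) (𝓝 a) := fun a b => by
    simpa using (hlog.const_div_atBot b).const_add a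
  have hIoo : ∀ᶠ r : ℝ in 𝓝[>] 0, r ∈ Ioo (0 : ℝ) 1 := Ioo_mem_nhdsGT one_pos
  refine tendsto_order.2 ⟨fun s hs => ?_, fun t ht => ?_⟩
  -- Lower bound for the quotient, from the Frostman bound; dividing by `log r < 0` reverses
  -- inequalities.
  · obtain ⟨s', hs1, hs2⟩ := exists_rat_btwn (max_lt hs (div_pos hc0 hL))
    have hs0 : (0 : ℝ) < s' := (le_max_right _ _).trans_lt hs1
    obtain ⟨K, hK⟩ := hF hx hc s' hs0 (by rwa [← lt_div_iff₀ hL])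
    filter_upwards [(hconst s' (Real.log K + s' * Real.log 2)).eventually_const_lt
      ((le_max_left _ _).trans_lt hs1), hIoo] with r hr hr1
    refine hr.trans_le ?_
    have hm := hmpos r hr1.1 hr1.2.le
    have hle := ENNReal.toReal_le_of_le_ofReal (by have := hr1.1; positivity)
      (ballMass_le_of_dyadic hs0.le hK hr1.1 hr1.2.le)
    have hKpos : (0 : ℝ) < K := by
      rcases (Nat.cast_nonneg K : (0 : ℝ) ≤ K).eq_or_lt with h | h
      · rw [← h, zero_mul] at hle; linarith
      · exact h
    have hr0 := hr1.1
    have hl := Real.log_le_log hm hle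
    rw [Real.log_mul hKpos.ne' (by positivity), Real.log_rpow (by positivity),
      Real.log_mul two_ne_zero hr0.ne'] at hl
    have hlr : Real.log r < 0 := Real.log_neg hr0 hr1.2
    rw [le_div_iff_of_neg hlr, add_mul, div_mul_cancel₀ _ hlr.ne]
    linarith
  -- Upper bound: the ball contains the cylinder of length `n` with `x ^ (n + 1) < (1 - x) r ≤ x ^
  -- n`.
  · obtain ⟨A', hA1, hA2⟩ := exists_between ((div_lt_iff₀ hL).1 ht)
    obtain ⟨N, hN⟩ := eventually_atTop.1 ((hi.eventually_const_lt (neg_lt_neg hA1)).and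
      (eventually_ge_atTop 1))
    have hA0 : 0 < A' := hc0.trans hA1
    have hsmall : ∀ᶠ r : ℝ in 𝓝[>] 0, r < x ^ N / (1 - x) :=
      (eventually_lt_nhds (by positivity)).filter_mono nhdsWithin_le_nhds
    filter_upwards [(hconst (A' / L) (A' / L * Real.log (1 - x))).eventually_lt_const
      ((div_lt_iff₀ hL).2 hA2), hIoo, hsmall] with r hr hr1 hrN
    refine lt_of_le_of_lt ?_ hr
    obtain ⟨n, hn1, hn2⟩ := hnear r hr1.1 hr1.2.le
    have hr0 := hr1.1
    have hlr : Real.log r < 0 := Real.log_neg hr0 hr1.2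
    have hNn : N ≤ n := by
      have h1 : x ^ (n + 1) < x ^ N := hn1.trans ((lt_div_iff₀' hx1).1 hrN)
      have := (pow_lt_pow_iff_right_of_lt_one₀ hx0 (by linarith)).1 h1
      omega
    obtain ⟨h1, h2⟩ := hN n hNn
    have hn0 : (0 : ℝ) < n := by exact_mod_cast h2
    rw [lt_div_iff₀ hn0] at h1
    have h3 := Real.log_le_log (wordWeight_pos hp0 hp1 i n) (hlow n r hn1)
    have h4 := Real.log_le_log (by positivity) hn2
    rw [Real.log_mul hx1.ne' hr0.ne', Real.log_pow] at h4
    have h5 : (n : ℝ) * L ≤ -Real.log (1 - x) - Real.log r := by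
      rw [hLdef]; linarith
    have h6 : A' * n ≤ A' / L * (-Real.log (1 - x) - Real.log r) := by
      rw [div_mul_eq_mul_div, le_div_iff₀ hL]
      nlinarith
    rw [div_le_iff_of_neg hlr, add_mul, div_mul_cancel₀ _ hlr.ne]
    linarith

theorem hasLocalDim_natProj (hp0 : 0 < (p : ℝ)) (hp1 : (p : ℝ) < 1)
    (hx : x ∈ Ioo (1 / 2 : ℝ) 0.66847) (hi : IsTypical p q i) (hF : FrostmanBelow p q x i)
    (hc : crossEntropy p q < -Real.log x) (hc0 : 0 < crossEntropy p q) :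
    HasLocalDim (bernoulliConvolution x p) (natProj x i) (crossEntropy p q / -Real.log x) := by
  have hx0 : 0 < x := by linarith [hx.1]
  have hx7 : x ≤ 7 / 10 := by have := hx.2; norm_num at this; linarith
  have hx1 : 0 < 1 - x := by linarith
  refine ⟨fun r hr => ?_, ?_⟩
  · rw [bernoulliConvolution_ball ⟨hx0.le, hx7⟩]
    obtain ⟨n, hn⟩ := exists_pow_lt_of_lt_one (mul_pos hx1 hr) (by linarith : x < 1)
    refine lt_of_lt_of_le (ENNReal.ofReal_pos.2 (wordWeight_pos hp0 hp1 i n))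
      (wordWeight_le_ballMass hx0 hx7 ?_)
    rw [div_lt_iff₀' hx1]
    exact (pow_le_pow_of_le_one hx0.le (by linarith) n.le_succ).trans_lt hn
  · simp_rw [measureReal_def, bernoulliConvolution_ball ⟨hx0.le, hx7⟩]
    exact tendsto_log_ballMass_div_log hp0 hp1 hx hi hF hc hc0

/-! ### The mass distribution principle -/

/-- The Frostman constant depends on the sequence, so the measure is restricted to a set of positive
mass on which one constant `K` works, then projected and compared with Hausdorff measure. -/
theorem le_dimH_of_ae_frostmanBound (hx : x ∈ Icc (0 : ℝ) (7 / 10)) {s : ℝ} (hs : 0 < s)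
    {D : Set ℝ} (hD : ∀ᵐ i ∂symbolicBernoulli q, natProj x i ∈ D ∧ FrostmanBound q x i s) :
    ENNReal.ofReal s ≤ dimH D := by
  set η := symbolicBernoulli q with hη
  let G : ℕ → Set (ℕ → Fin 2) := fun K =>
    {i | ∀ n : ℕ, ballMass q x i ((1 / 2) ^ n) ≤ ENNReal.ofReal (K * ((1 / 2 : ℝ) ^ n) ^ s)}
  obtain ⟨K, hGK⟩ : ∃ K, η (G K) ≠ 0 := by
    by_contra hn
    push Not at hn
    have h0 : ∀ᵐ i ∂η, i ∉ ⋃ K, G K := measure_eq_zero_iff_ae_notMem.1 (measure_iUnion_null hn)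
    obtain ⟨i, h1, h2⟩ := (h0.and hD).exists
    obtain ⟨K, hK⟩ := h2.2
    exact h1 (mem_iUnion.2 ⟨K, hK⟩)
  have hGm : MeasurableSet (G K) := by
    have : G K = ⋂ n : ℕ, {i | ballMass q x i ((1 / 2) ^ n) ≤
        ENNReal.ofReal (K * ((1 / 2 : ℝ) ^ n) ^ s)} := by ext; simp [G]
    rw [this]
    refine MeasurableSet.iInter fun n => measurableSet_le ?_ measurable_const
    exact (measurable_ballMass ((1 / 2) ^ n)).comp
      (f := fun i : ℕ → Fin 2 => (q, x, i)) (by fun_prop)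
  set μ : Measure ℝ := (η.restrict (G K)).map (natProj x) with hμ
  have hnm := measurable_natProj hx
  -- `K + 1` instead of `K` makes `c` invertible without discussing `K = 0`.
  set c : ENNReal := ENNReal.ofReal ((K + 1) * 2 ^ s) with hc
  have hc0 : c ≠ 0 := by rw [hc]; positivity
  have hct : c ≠ ⊤ := ENNReal.ofReal_ne_top
  have hμU : ∀ U : Set ℝ, Metric.ediam U ≤ ENNReal.ofReal (1 / 2) → μ U ≤ c * Metric.ediam U ^ s := by
    intro U hU
    set d := (Metric.ediam U).toReal with hd
    have hdt : Metric.ediam U ≠ ⊤ := ne_top_of_le_ne_top ENNReal.ofReal_ne_top hU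
    have hd1 : d ≤ 1 / 2 := ENNReal.toReal_le_of_le_ofReal (by norm_num) hU
    have hdE : Metric.ediam U = ENNReal.ofReal d := (ENNReal.ofReal_toReal hdt).symm
    have hbound : μ U ≤ ENNReal.ofReal (K * (2 * d) ^ s) := by
      refine (measure_mono subset_closure).trans ?_
      rw [hμ, Measure.map_apply hnm isClosed_closure.measurableSet,
        Measure.restrict_apply (hnm isClosed_closure.measurableSet)]
      rcases (natProj x ⁻¹' closure U ∩ G K).eq_empty_or_nonempty with he | ⟨i, hiU, hiG⟩
      · rw [he, measure_empty]; exact zero_le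
      -- Balls are open, so `closure U` is only inside balls of radius `r > d`; then `r` decreases
      -- to `d`, which also covers `d = 0`.
      · have hr : ∀ᶠ r in 𝓝[>] d, η (natProj x ⁻¹' closure U ∩ G K) ≤
            ENNReal.ofReal (K * (2 * r) ^ s) := by
          filter_upwards [Ioo_mem_nhdsGT (show d < 1 by linarith)] with r hr
          refine le_trans (measure_mono fun j hj => ?_)
            (ballMass_le_of_dyadic hs.le hiG (ENNReal.toReal_nonneg.trans_lt hr.1) hr.2.le)
          have h1 := Metric.edist_le_ediam_of_mem (show natProj x i ∈ closure U from hiU)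
            (show natProj x j ∈ closure U from hj.1)
          rw [Metric.ediam_closure, hdE, edist_dist, Real.dist_eq] at h1
          simp only [mem_ofPred_eq, clip_of_mem hx]
          exact ((ENNReal.ofReal_le_ofReal_iff ENNReal.toReal_nonneg).1 h1).trans_lt hr.1
        refine ge_of_tendsto ?_ hr
        have hcont : Continuous fun r : ℝ => ENNReal.ofReal (K * (2 * r) ^ s) :=
          ENNReal.continuous_ofReal.comp (continuous_const.mul
            ((Real.continuous_rpow_const hs.le).comp (continuous_const.mul continuous_id)))
        exact hcont.continuousAt.tendsto.mono_left nhdsWithin_le_nhds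
    refine hbound.trans ?_
    have hd0 : 0 ≤ d := ENNReal.toReal_nonneg
    rw [hdE, ENNReal.ofReal_rpow_of_nonneg hd0 hs.le, hc, ← ENNReal.ofReal_mul (by positivity),
      Real.mul_rpow (by norm_num) hd0, ← mul_assoc]
    refine ENNReal.ofReal_le_ofReal ?_
    gcongr
    linarith
  have hle : c⁻¹ • μ ≤ Measure.hausdorffMeasure s := by
    refine Measure.le_hausdorffMeasure s _ (ENNReal.ofReal (1 / 2)) (by simp) fun U hU => ?_
    rw [Measure.smul_apply, smul_eq_mul]
    calc c⁻¹ * μ U ≤ c⁻¹ * (c * Metric.ediam U ^ s) := by gcongr; exact hμU U hU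
      _ = Metric.ediam U ^ s := by
        rw [← mul_assoc, ENNReal.inv_mul_cancel hc0 hct, one_mul]
  -- `D` need not be measurable; the inequality for the image measure of an arbitrary set suffices.
  have hμD : μ D ≠ 0 := by
    intro h0
    have h1 : η.restrict (G K) (natProj x ⁻¹' D) = 0 :=
      le_antisymm ((Measure.le_map_apply hnm.aemeasurable D).trans h0.le) zero_le
    have h2 : η.restrict (G K) (natProj x ⁻¹' D)ᶜ = 0 := by
      refine measure_mono_null (fun i hi => ?_)
        (ae_iff.1 (ae_restrict_of_ae (s := G K) hD))
      exact fun h => hi h.1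
    have h3 : η.restrict (G K) univ = 0 := by
      rw [← union_compl_self (natProj x ⁻¹' D)]
      exact measure_union_null h1 h2
    rw [Measure.restrict_apply_univ] at h3
    exact hGK h3
  have hH : Measure.hausdorffMeasure ((s.toNNReal : NNReal) : ℝ) D ≠ 0 := by
    rw [Real.coe_toNNReal s hs.le]
    intro h0
    have := le_antisymm ((hle D).trans h0.le) zero_le
    rw [Measure.smul_apply, smul_eq_mul, mul_eq_zero] at this
    exact this.elim (ENNReal.inv_ne_zero.2 hct) hμD
  exact le_dimH_of_hausdorffMeasure_ne_zero hH

end LocalDim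

/-! ### Entropy -/

theorem binEntropy_eq_crossEntropy (q : ℝ) : Real.binEntropy q = crossEntropy q q := by
  rw [Real.binEntropy, crossEntropy, Real.log_inv, Real.log_inv]
  ring

/-- Gibbs' inequality, from `log t ≤ t - 1` at the two likelihood ratios. -/
theorem crossEntropy_self_le {p q : ℝ} (hp0 : 0 < p) (hp1 : p < 1) (hq0 : 0 < q) (hq1 : q < 1) :
    crossEntropy q q ≤ crossEntropy p q := by
  have h1 := Real.log_le_sub_one_of_pos (div_pos hp0 hq0)
  have h2 := Real.log_le_sub_one_of_pos (div_pos (sub_pos.2 hp1) (sub_pos.2 hq1))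
  rw [Real.log_div hp0.ne' hq0.ne'] at h1
  rw [Real.log_div (sub_pos.2 hp1).ne' (sub_pos.2 hq1).ne'] at h2
  have h3 := mul_le_mul_of_nonneg_left h1 hq0.le
  have h4 := mul_le_mul_of_nonneg_left h2 (sub_pos.2 hq1).le
  have e3 : q * (p / q - 1) = p - q := by field_simp
  have e4 : (1 - q) * ((1 - p) / (1 - q) - 1) = q - p := by
    have := (sub_pos.2 hq1).ne'
    field_simp
    ring
  unfold crossEntropy
  linarith

theorem binEntropy_div_le_dimH {p q : unitInterval} {x : ℝ} (hp0 : 0 < (p : ℝ))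
    (hp1 : (p : ℝ) < 1) (hq0 : 0 < (q : ℝ)) (hq1 : (q : ℝ) < 1)
    (hx : x ∈ Ioo (1 / 2 : ℝ) 0.66847) (hc : crossEntropy p q < -Real.log x)
    (hp : ∀ᵐ i ∂symbolicBernoulli q, FrostmanBelow p q x i)
    (hq : ∀ᵐ i ∂symbolicBernoulli q, FrostmanBelow q q x i) :
    ENNReal.ofReal (Real.binEntropy q / -Real.log x) ≤
      dimH (localDimLevelSet (bernoulliConvolution x p) (crossEntropy p q / -Real.log x)) := by
  have hx0 : 0 < x := by linarith [hx.1]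
  have hx7 : x ≤ 7 / 10 := by have := hx.2; norm_num at this; linarith
  have hL : 0 < -Real.log x := by linarith [Real.log_neg hx0 (by linarith)]
  have hle := crossEntropy_self_le hp0 hp1 hq0 hq1
  have hpos : 0 < crossEntropy q q := by
    rw [← binEntropy_eq_crossEntropy]; exact Real.binEntropy_pos hq0 hq1
  rw [binEntropy_eq_crossEntropy]
  refine le_of_forall_lt fun b hb => ?_
  obtain ⟨b', hb1, hb2⟩ := exists_between hb
  have hbt : b' ≠ ⊤ := hb2.ne_top
  have hb3 : b'.toReal < crossEntropy q q / -Real.log x :=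
    (ENNReal.lt_ofReal_iff_toReal_lt hbt).1 hb2
  obtain ⟨s, hs1, hs2⟩ := exists_rat_btwn hb3
  have hs0 : (0 : ℝ) < s := ENNReal.toReal_nonneg.trans_lt hs1
  refine hb1.trans_le ?_
  refine le_trans ?_ (le_dimH_of_ae_frostmanBound (q := q) ⟨hx0.le, hx7⟩ hs0 ?_)
  · rw [← ENNReal.ofReal_toReal hbt]
    exact ENNReal.ofReal_le_ofReal hs1.le
  · filter_upwards [hp, hq, ae_isTypical hp0 hp1 q] with i h1 h2 h3
    exact ⟨hasLocalDim_natProj hp0 hp1 hx h3 h1 hc (hpos.trans_le hle),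
      h2 hx (hle.trans_lt hc) s hs0 ((lt_div_iff₀ hL).1 hs2)⟩

/-! ### From almost every `q` to almost every `α`. -/

theorem ae_unitInterval_mem_Ioo : ∀ᵐ q : unitInterval, 0 < (q : ℝ) ∧ (q : ℝ) < 1 := by
  filter_upwards [Measure.ae_ne volume (0 : unitInterval), Measure.ae_ne volume (1 : unitInterval)]
    with q h0 h1
  exact ⟨q.2.1.lt_of_ne fun h => h0 (Subtype.ext h.symm), q.2.2.lt_of_ne fun h => h1 (Subtype.ext h)⟩

/-- A property of almost every point of the unit interval holds at almost every point of the line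
that a nonconstant affine map sends into the unit interval. -/
theorem ae_affine_of_ae_unitInterval {P : unitInterval → Prop} (hP : ∀ᵐ q : unitInterval, P q)
    {c : ℝ} (hc : c ≠ 0) (d : ℝ) :
    ∀ᵐ a : ℝ, ∀ h : c * a + d ∈ unitInterval, P ⟨c * a + d, h⟩ := by
  have h1 : volume ((↑) '' {q : unitInterval | ¬P q} : Set ℝ) = 0 := by
    rw [← unitInterval.volume_apply]; exact hP
  have h2 : volume ((fun a => c * a) ⁻¹' ((fun a => a + d) ⁻¹'
      ((↑) '' {q : unitInterval | ¬P q}))) = 0 := by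
    rw [Real.volume_preimage_mul_left hc, measure_preimage_add_right, h1, mul_zero]
  filter_upwards [measure_eq_zero_iff_ae_notMem.1 h2] with a ha h
  by_contra hn
  exact ha ⟨⟨_, h⟩, hn, rfl⟩

theorem mainTheorem3 (p : unitInterval) (hp0 : 0 < (p : ℝ)) (hp : (p : ℝ) < 1 / 2) :
    ∀ᵐ lam : ℝ ∂volume, lam ∈ Ioo (1 / 2 : ℝ) (min 0.66847 (1 - (p : ℝ))) →
      ∀ᵐ α : ℝ ∂volume, α ∈ Icc (Real.log (1 - (p : ℝ)) / Real.log lam) 1 →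
        0 < dimH (localDimLevelSet (bernoulliConvolution lam p) α) ∧
          ∃ q ∈ Icc (0 : ℝ) 1,
            Real.log lam * α = q * Real.log (p : ℝ) + (1 - q) * Real.log (1 - (p : ℝ)) ∧
              ENNReal.ofReal (Real.binEntropy q / |Real.log lam|) ≤
                dimH (localDimLevelSet (bernoulliConvolution lam p) α) := by
  have hp1 : (p : ℝ) < 1 := by linarith
  filter_upwards [ae_ae_ae_frostmanBelow (f := fun _ => p) measurable_const
      (ae_of_all _ fun _ => ⟨hp0, hp1⟩),
    ae_ae_ae_frostmanBelow (f := id) measurable_id ae_unitInterval_mem_Ioo] with x hxp hxq hx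
  have hxI : x ∈ Ioo (1 / 2 : ℝ) 0.66847 := ⟨hx.1, hx.2.trans_le (min_le_left _ _)⟩
  have hx0 : 0 < x := by linarith [hx.1]
  have hx1 : x < 1 := by linarith [hx.2.trans_le (min_le_right _ _)]
  have hlx : Real.log x < 0 := Real.log_neg hx0 hx1
  set u := Real.log (1 - (p : ℝ)) with hu
  set v := Real.log (p : ℝ) with hv
  have hvu : v - u < 0 := sub_neg.2 (Real.log_lt_log hp0 (by linarith))
  have hvx : v < Real.log x := Real.log_lt_log hp0 (by linarith [hx.1])
  -- The affine map solves `α log x = q v + (1 - q) u` for `q`; `p < 1/2` makes `v - u` nonzero.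
  have key := ae_affine_of_ae_unitInterval ((hxp.and hxq).and ae_unitInterval_mem_Ioo)
    (div_ne_zero hlx.ne hvu.ne) (-u / (v - u))
  -- Both endpoints are discarded: `α = 1` violates the strict bound on the cross entropy, and the
  -- left endpoint gives `q = 0`, where the entropy vanishes.
  filter_upwards [key, Measure.ae_ne volume (1 : ℝ),
    Measure.ae_ne volume (u / Real.log x)] with α hα hα1 hα0 hmem
  set q := Real.log x / (v - u) * α + -u / (v - u) with hq
  have hqe : q * (v - u) = Real.log x * α - u := by
    rw [hq]
    have := hvu.ne
    field_simp
    ring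
  have h1 : α < 1 := lt_of_le_of_ne hmem.2 hα1
  have h0 : Real.log x * α < u := by
    have := lt_of_le_of_ne hmem.1 (Ne.symm hα0)
    rwa [div_lt_iff_of_neg hlx, mul_comm] at this
  have h2 : Real.log x < Real.log x * α := by nlinarith
  have hq0 : 0 < q := by
    by_contra h
    push Not at h
    nlinarith
  have hq1 : q < 1 := by
    by_contra h
    push Not at h
    nlinarith
  obtain ⟨⟨hFp, hFq⟩, -⟩ := hα ⟨hq0.le, hq1.le⟩
  have hce : crossEntropy p q = -(Real.log x * α) := by
    rw [crossEntropy]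
    linarith
  have hdim := binEntropy_div_le_dimH (p := p) (q := ⟨q, hq0.le, hq1.le⟩) hp0 hp1 hq0 hq1 hxI
    (by show crossEntropy p q < _; rw [hce]; linarith) hFp hFq
  have hα' : crossEntropy p q / -Real.log x = α := by
    rw [hce, neg_div_neg_eq, mul_div_cancel_left₀ _ hlx.ne]
  simp only [hα'] at hdim
  rw [abs_of_neg hlx]
  refine ⟨lt_of_lt_of_le (ENNReal.ofReal_pos.2 ?_) hdim, q, ⟨hq0.le, hq1.le⟩, by linarith, hdim⟩
  exact div_pos (Real.binEntropy_pos hq0 hq1) (by linarith)
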